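/- **Setting.** Let $V_1,\dots,V_k$ be finite sets and $\mu$ a probability measure on $V_1\times\cdots\times V_k$. For $S\subseteq[k]$ let $\mu_S$ be the projection of $\mu$ to the coordinates in $S$, $V_S$ the support of $\mu_S$, and for $x\in V_S$ let $\mu_x$ (the link of $x$) be $\mu$ conditioned on $y_S=x$. A probability measure $\nu$ on $A\times B$ is *$\epsilon$-pseudorandom* if for all $f_1\colon A\to\mathbb R$, $f_2\colon B\to\mathbb R$ $$\bigl|\mathbb E_{(a,b)\sim\nu}[f_1(a)f_2(b)]-\mathbb E_\nu[f_1(a)]\,\mathbb E_\nu[f_2(b)]\bigr|\le\epsilon\sqrt{\mathrm{Var}_\nu[f_1(a)]\,\mathrm{Var}_\nu[f_2(b)]}.$$ The measure $\mu$ is *$\epsilon$-product* if for all $|S|\le k-2$ and $x\in V_S$, every projection of $\mu_x$ to two coordinates outside $S$ is $\epsilon$-pseudorandom. Put $A_Sf(x)=\mathbb E_{y\sim\mu}[f(y)\mid y_S=x_S]$, $f^{=S}=\sum_{T\subseteq S}(-1)^{|S\setminus T|}A_Tf$ and $f^{\le d}=\sum_{|S|\le d}f^{=S}$. The function $f$ is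 *$(d,\delta)$-global* if $\|f(x,\cdot)\|_{L^2(\mu_x)}\le\delta$ for all $|S|\le d$ and $x\in V_S$. Norms $\|\cdot\|_2$ are taken in $L^2(\mu)$. A finite nonempty simplicial complex $X$, pure of dimension $k-1$, is an *$\epsilon$-HDX* if for each face with at most $k-2$ vertices (including the empty face) all nontrivial eigenvalues of the random walk on the $1$-skeleton of its link are at most $\epsilon$ in absolute value; here an edge $\{a,b\}$ of the link of $s$ is weighted by the number of top faces containing $s\cup\{a,b\}$, and the nontrivial eigenvalues are those on the orthogonal complement of the constants with respect to the stationary distribution. Let $X(k)$ be the set of faces with $k$ vertices. It is identified with the probability measure $\mu$ on $V^k$ given by a uniformly random element of $X(k)$ in a uniformly random order, and $f\colon X(k)\to\{0,1\}$ with the corresponding function of the ordered face; $f^{\le d}$, globalness and norms are then as above. **Theorem.** 1. For every $k$ there is a constant $C=C(k)>0$ such that for all $\epsilon\ge0$, $d\in\mathbb N$ and $\delta$: if $\mu$ is $\epsilon$-product and $f$, with values in $\{0,1\}$ on the support of $\mu$, is $(d,\delta)$-global, then $$\|f^{\le d}\|_2^2\le\bigl(C\sqrt\epsilon+(200d)^d\,\delta^{1/2}\bigr)\|f\|_2^2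 .$$ The same holds for every $(d,\delta)$-global $f\colon X(k)\to\{0,1\}$ on an $\epsilon$-HDX $X$ of dimension $k-1$. 2. For every $\zeta>0$ and $d\in\mathbb N$ there is $\delta_0=\delta_0(\zeta,d)>0$, and for every $k$ there is $\epsilon_0=\epsilon_0(\zeta,k,d)>0$, such that whenever $0\le\epsilon\le\epsilon_0$ and $\delta\le\delta_0$, every such $f$, on an $\epsilon$-product measure or on an $\epsilon$-HDX, satisfies $$\|f^{\le d}\|_2^2\le\zeta\|f\|_2^2 .$$ (Here $(200d)^d=1$ for $d=0$.) -/

import Mathlib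

universe u v

noncomputable section

namespace EpsProduct

/-- The expectation of `g` under the (finitely supported) weight function `ν`. -/
def expect {α : Type*} [Fintype α] (ν : α → ℝ) (g : α → ℝ) : ℝ :=
  ∑ a, ν a * g a

/-- The variance of `g` under `ν`. -/
def variance {α : Type*} [Fintype α] (ν : α → ℝ) (g : α → ℝ) : ℝ :=
  expect ν (fun a => (g a - expect ν g) ^ 2)

/-- The norm `‖g‖₂` in `L²(ν)`. -/
def l2norm {α : Type*} [Fintype α] (ν : α → ℝ) (g : α → ℝ) : ℝ :=
  √(expect ν (fun a => g a ^ 2))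

/-- A probability weight `ν` on `α × β`, seen as a weighted bipartite graph, is
`ε`-pseudorandom. Functions of one coordinate are pulled back to `α × β`; their expectation
and variance under `ν` are those under the corresponding marginal of `ν`. -/
def IsPseudorandom {α β : Type*} [Fintype α] [Fintype β] (ε : ℝ) (ν : α × β → ℝ) : Prop :=
  ∀ (f₁ : α → ℝ) (f₂ : β → ℝ),
    |expect ν (fun p => f₁ p.1 * f₂ p.2)
        - expect ν (fun p => f₁ p.1) * expect ν (fun p => f₂ p.2)|
      ≤ ε * √(variance ν (fun p => f₁ p.1) * variance ν (fun p => f₂ p.2))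

section Tuples

variable {k : ℕ} {V : Fin k → Type u} [∀ i, Fintype (V i)]

open scoped Classical in
/-- `μ_S(x_S)`: the mass that the projection of `μ` to the coordinates in `S` gives to `x_S`.
In particular `x_S ∈ V_S` (the support of `μ_S`) if and only if `0 < marginal μ S x`. -/
def marginal (μ : (∀ i, V i) → ℝ) (S : Finset (Fin k)) (x : ∀ i, V i) : ℝ :=
  ∑ y : ∀ i, V i, if ∀ i ∈ S, y i = x i then μ y else 0

open scoped Classical in
/-- The link of `μ` at `x_S`, i.e. `μ` conditioned on the coordinates in `S` being `x_S`. It is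
written as a weight on full tuples that is carried by the tuples extending `x_S`. -/
def link (μ : (∀ i, V i) → ℝ) (S : Finset (Fin k)) (x : ∀ i, V i) : (∀ i, V i) → ℝ :=
  fun y => (if ∀ i ∈ S, y i = x i then μ y else 0) / marginal μ S x

open scoped Classical in
/-- The projection of `μ` to the coordinates `i` and `j`. -/
def skeleton (μ : (∀ i, V i) → ℝ) (i j : Fin k) : V i × V j → ℝ :=
  fun p => ∑ y : ∀ i, V i, if y i = p.1 ∧ y j = p.2 then μ y else 0

/-- `μ` is an `ε`-product measure: for every `S` of size at most `k - 2` and every `x ∈ V_S`, all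
the projections of the link of `x` to two coordinates outside `S` are `ε`-pseudorandom. -/
def IsEpsProduct (ε : ℝ) (μ : (∀ i, V i) → ℝ) : Prop :=
  ∀ S : Finset (Fin k), S.card + 2 ≤ k → ∀ x : ∀ i, V i, 0 < marginal μ S x →
    ∀ i j : Fin k, i ∉ S → j ∉ S → i ≠ j → IsPseudorandom ε (skeleton (link μ S x) i j)

/-- The averaging operator `A_S`: `(A_S f)(x) = 𝔼 [f(y) | y_S = x_S]`. -/
def average (μ : (∀ i, V i) → ℝ) (S : Finset (Fin k)) (f : (∀ i, V i) → ℝ) :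
    (∀ i, V i) → ℝ :=
  fun x => expect (link μ S x) f

/-- The Efron–Stein component `f^{=S} = ∑_{T ⊆ S} (-1)^{|S \ T|} A_T f`. -/
def efronStein (μ : (∀ i, V i) → ℝ) (S : Finset (Fin k)) (f : (∀ i, V i) → ℝ) :
    (∀ i, V i) → ℝ :=
  fun x => ∑ T ∈ S.powerset, (-1 : ℝ) ^ (S \ T).card * average μ T f x

/-- The low degree part `f^{≤ d} = ∑_{|S| ≤ d} f^{=S}`. -/
def lowDegree (μ : (∀ i, V i) → ℝ) (d : ℕ) (f : (∀ i, V i) → ℝ) : (∀ i, V i) → ℝ :=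
  fun x => ∑ S : Finset (Fin k) with S.card ≤ d, efronStein μ S f x

/-- `f` is `(d, δ)`-global: `‖f(x, ·)‖_{L²(μ_x)} ≤ δ` for all `|S| ≤ d` and all `x ∈ V_S`. -/
def IsGlobal (μ : (∀ i, V i) → ℝ) (d : ℕ) (δ : ℝ) (f : (∀ i, V i) → ℝ) : Prop :=
  ∀ S : Finset (Fin k), S.card ≤ d → ∀ x : ∀ i, V i, 0 < marginal μ S x →
    l2norm (link μ S x) f ≤ δ

end Tuples

section Complexes

variable {V : Type v} [Fintype V] [DecidableEq V]

/-- `X` is a nonempty pure complex all of whose maximal faces have `k` vertices (so that it is of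
dimension `k - 1`). -/
def IsPure (X : PreAbstractSimplicialComplex V) (k : ℕ) : Prop :=
  X.faces.Nonempty ∧ ∀ s ∈ X.faces, ∃ t ∈ X.faces, s ⊆ t ∧ t.card = k

open scoped Classical in
/-- The number of top faces (faces with `k` vertices) of `X` that contain `s`. -/
def degree (X : PreAbstractSimplicialComplex V) (k : ℕ) (s : Finset V) : ℕ :=
  (Finset.univ.filter fun t : Finset V => t ∈ X.faces ∧ t.card = k ∧ s ⊆ t).card

/-- The weight of the edge `{a, b}` in the `1`-skeleton of the link of `s`: the number of top
faces of `X` that contain `s ∪ {a, b}` (zero if `a`, `b` are not distinct vertices outside `s`). -/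
def linkWeight (X : PreAbstractSimplicialComplex V) (k : ℕ) (s : Finset V) (a b : V) : ℝ :=
  if a ∉ s ∧ b ∉ s ∧ a ≠ b then (degree X k (s ∪ {a, b}) : ℝ) else 0

/-- The weighted degree of the vertex `a` in the `1`-skeleton of the link of `s`. -/
def linkDegree (X : PreAbstractSimplicialComplex V) (k : ℕ) (s : Finset V) (a : V) : ℝ :=
  ∑ b, linkWeight X k s a b

/-- The transition matrix of the random walk on the weighted `1`-skeleton of the link of `s`.
The rows and columns of vertices that are not in the link vanish. -/
def linkWalk (X : PreAbstractSimplicialComplex V) (k : ℕ) (s : Finset V) : Matrix V V ℝ :=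
  fun a b => linkWeight X k s a b / linkDegree X k s a

/-- `X` is an `ε`-HDX of dimension `k - 1`: it is pure, and in the (weighted) `1`-skeleton of the
link of each face with at most `k - 2` vertices, the empty one included, all the eigenvalues of
the random walk other than the trivial eigenvalue `1` of the constant function (i.e. the
eigenvalues on the orthogonal complement of the constants with respect to the stationary
distribution) are at most `ε` in absolute value. -/
def IsHDX (ε : ℝ) (X : PreAbstractSimplicialComplex V) (k : ℕ) : Prop :=
  IsPure X k ∧
    ∀ s : Finset V, (s = ∅ ∨ s ∈ X.faces) → s.card + 2 ≤ k →
      ∀ (l : ℝ) (φ : V → ℝ), φ ≠ 0 → (linkWalk X k s).mulVec φ = l • φ →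
        ∑ a, linkDegree X k s a * φ a = 0 → |l| ≤ ε

open scoped Classical in
/-- The set of all orderings `(x₁, …, x_k)` of the faces in `X(k)`. -/
def orderedFaces (X : PreAbstractSimplicialComplex V) (k : ℕ) : Finset (Fin k → V) :=
  Finset.univ.filter fun x => Function.Injective x ∧ Finset.univ.image x ∈ X.faces

/-- The measure on `V^k` identified with `X(k)`: a uniformly random face in `X(k)`, in a uniformly
random order. -/
def faceMeasure (X : PreAbstractSimplicialComplex V) (k : ℕ) : (Fin k → V) → ℝ :=
  fun x => if x ∈ orderedFaces X k then 1 / ((orderedFaces X k).card : ℝ) else 0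

/-- A function on `X(k)`, seen as a function of the ordered face. -/
def onTuples (k : ℕ) (f : Finset V → ℝ) : (Fin k → V) → ℝ :=
  fun x => f (Finset.univ.image x)

end Complexes

end EpsProduct

end

open EpsProduct

noncomputable section

namespace EpsProduct

/-! ### Expectations, variances and L² norms of a finite weight. -/

section Expectation

variable {α β : Type*} [Fintype α] [Fintype β] {ν : α → ℝ} {f g h : α → ℝ}

/-! The proof reduces the level inequality to a fourth moment bound. The components `f^{=S}` are
nearly orthogonal, so `‖f^{≤d}‖²` exceeds `⟨f^{≤d}, f⟩` by at most `O_k(ε)‖f‖²`. As `f² = f`, two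
applications of Cauchy–Schwarz give `⟨g, f⟩⁴ ≤ E[g⁴] ‖f‖⁶`. With `g = f^{≤d}` it then suffices to
show `E[g⁴] ≤ C^d δ² ‖f‖²` with `C` independent of `k`
(`IsEpsProduct.expect_lowDegree_pow_four_le`); a fourth root produces `√δ ‖f‖²`.

Near-orthogonality comes from `A_S A_T ≈ A_{S ∩ T}` (`IsEpsProduct.average_average_inter`), which is
obtained from pseudorandomness in links by adding one coordinate at a time. Consequently, averaging
out coordinate `i` nearly kills `f^{=T}` if `i ∈ T` and fixes it if `i ∉ T`.

For the fourth moment, each coordinate splits a function into a conditional expectation and a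
remainder. On an arbitrary measure this gives `E[g⁴] ≤ ∑_{S,T} 4^{|S ∪ T|} E[(D_S g)² (D_T g)²]`
(`expect_sq_mul_sq_le`), where `D_S` is `iteratedPart`. On an `ε`-product measure `D_S f^{≤d}` is
close to `f^{=S}` if `|S| ≤ d` and to `0` otherwise, so only weights up to `16^d` matter. In
`E[(f^{=S})² (f^{=T})²]` the component `f^{=T}` is a signed sum, over `J ⊆ S ∩ T`, of components on
`T \ S` of the restrictions of `f` to links of `x_J`. Given `x_J`, these are nearly independent of
`f^{=S}`, and Parseval inside the link bounds their total mass by about `δ²`, by globalness.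
Parseval for `f^{=S}` supplies the remaining `‖f‖²`.

For an `ε`-HDX, the projections of links to two coordinates are multiples of the edge weights in
links of faces, so the eigenvalue bound makes the face measure `ε`-product (`IsHDX.isEpsProduct`).
-/

lemma expect_add (ν f g : α → ℝ) : expect ν (f + g) = expect ν f + expect ν g := by
  simp [expect, mul_add, Finset.sum_add_distrib]

lemma expect_sub (ν f g : α → ℝ) : expect ν (f - g) = expect ν f - expect ν g := by
  simp [expect, mul_sub, Finset.sum_sub_distrib]

lemma expect_smul (ν : α → ℝ) (c : ℝ) (f : α → ℝ) : expect ν (c • f) = c * expect ν f := by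
  simp only [expect, Finset.mul_sum, Pi.smul_apply, smul_eq_mul]
  exact Finset.sum_congr rfl fun _ _ => by ring

lemma expect_sum {ι : Type*} (ν : α → ℝ) (s : Finset ι) (F : ι → α → ℝ) :
    expect ν (∑ i ∈ s, F i) = ∑ i ∈ s, expect ν (F i) := by
  simp only [expect, Finset.sum_apply, Finset.mul_sum]
  exact Finset.sum_comm

lemma expect_congr (H : ∀ a, ν a ≠ 0 → f a = g a) : expect ν f = expect ν g := by
  refine Finset.sum_congr rfl fun a _ => ?_
  by_cases ha : ν a = 0
  · simp [ha]
  · rw [H a ha]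

lemma expect_mono (hν : ∀ a, 0 ≤ ν a) (H : ∀ a, ν a ≠ 0 → f a ≤ g a) :
    expect ν f ≤ expect ν g := by
  refine Finset.sum_le_sum fun a _ => ?_
  by_cases ha : ν a = 0
  · simp [ha]
  · exact mul_le_mul_of_nonneg_left (H a ha) (hν a)

lemma expect_nonneg (hν : ∀ a, 0 ≤ ν a) (H : ∀ a, ν a ≠ 0 → 0 ≤ f a) : 0 ≤ expect ν f := by
  have := expect_mono (f := 0) hν H
  simpa [expect] using this

lemma expect_sq_nonneg (hν : ∀ a, 0 ≤ ν a) (f : α → ℝ) : 0 ≤ expect ν (f ^ 2) :=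
  expect_nonneg hν fun a _ => sq_nonneg (f a)

lemma expect_const (hν : ∑ a, ν a = 1) (c : ℝ) : expect ν (fun _ => c) = c := by
  simp [expect, ← Finset.sum_mul, hν]

lemma l2norm_nonneg (ν f : α → ℝ) : 0 ≤ l2norm ν f := Real.sqrt_nonneg _

lemma l2norm_sq (hν : ∀ a, 0 ≤ ν a) (f : α → ℝ) : l2norm ν f ^ 2 = expect ν (f ^ 2) :=
  Real.sq_sqrt (expect_sq_nonneg hν f)

lemma l2norm_congr (H : ∀ a, ν a ≠ 0 → f a = g a) : l2norm ν f = l2norm ν g := by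
  unfold l2norm
  rw [expect_congr fun a ha => by rw [H a ha]]

/-- The isometric embedding of `L²(ν)` into a Euclidean space. -/
def toEuclidean (ν f : α → ℝ) : EuclideanSpace ℝ α := WithLp.toLp 2 fun a => √(ν a) * f a

lemma norm_toEuclidean (hν : ∀ a, 0 ≤ ν a) (f : α → ℝ) : ‖toEuclidean ν f‖ = l2norm ν f := by
  simp only [toEuclidean, EuclideanSpace.norm_eq, l2norm, expect, Real.norm_eq_abs, sq_abs,
    mul_pow]
  exact congrArg _ (Finset.sum_congr rfl fun a _ => by rw [Real.sq_sqrt (hν a)])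

lemma inner_toEuclidean (hν : ∀ a, 0 ≤ ν a) (f g : α → ℝ) :
    inner ℝ (toEuclidean ν f) (toEuclidean ν g) = expect ν (f * g) := by
  simp only [toEuclidean, PiLp.inner_apply, RCLike.inner_apply, conj_trivial, expect,
    Pi.mul_apply]
  refine Finset.sum_congr rfl fun a _ => ?_
  linear_combination (f a * g a) * Real.mul_self_sqrt (hν a)

omit [Fintype α] in
lemma toEuclidean_add (ν f g : α → ℝ) :
    toEuclidean ν (f + g) = toEuclidean ν f + toEuclidean ν g := by
  ext a; simp [toEuclidean, mul_add]

lemma l2norm_smul (hν : ∀ a, 0 ≤ ν a) (c : ℝ) (f : α → ℝ) :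
    l2norm ν (c • f) = |c| * l2norm ν f := by
  rw [← norm_toEuclidean hν, ← norm_toEuclidean hν, ← Real.norm_eq_abs, ← norm_smul]
  congr 1
  ext a; simp [toEuclidean, mul_left_comm]

lemma l2norm_zero (ν : α → ℝ) : l2norm ν 0 = 0 := by simp [l2norm, expect]

lemma l2norm_neg (ν f : α → ℝ) : l2norm ν (-f) = l2norm ν f := by simp [l2norm]

lemma l2norm_add_le (hν : ∀ a, 0 ≤ ν a) (f g : α → ℝ) :
    l2norm ν (f + g) ≤ l2norm ν f + l2norm ν g := by
  simp only [← norm_toEuclidean hν, toEuclidean_add]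
  exact norm_add_le _ _

lemma l2norm_sum_le (hν : ∀ a, 0 ≤ ν a) {ι : Type*} (s : Finset ι) (F : ι → α → ℝ) :
    l2norm ν (∑ i ∈ s, F i) ≤ ∑ i ∈ s, l2norm ν (F i) := by
  classical
  induction s using Finset.induction_on with
  | empty => simp [l2norm_zero]
  | insert i s hi ih =>
    rw [Finset.sum_insert hi, Finset.sum_insert hi]
    exact (l2norm_add_le hν _ _).trans (by gcongr)

lemma abs_expect_mul_le (hν : ∀ a, 0 ≤ ν a) (f g : α → ℝ) :
    |expect ν (f * g)| ≤ l2norm ν f * l2norm ν g := by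
  simp only [← inner_toEuclidean hν, ← norm_toEuclidean hν]
  exact abs_real_inner_le_norm _ _

lemma expect_mul_le (hν : ∀ a, 0 ≤ ν a) (f g : α → ℝ) :
    expect ν (f * g) ≤ l2norm ν f * l2norm ν g :=
  (le_abs_self _).trans (abs_expect_mul_le hν f g)

lemma expect_mul_sq_le (hν : ∀ a, 0 ≤ ν a) (f g : α → ℝ) :
    expect ν (f * g) ^ 2 ≤ expect ν (f ^ 2) * expect ν (g ^ 2) := by
  rw [← l2norm_sq hν, ← l2norm_sq hν, ← mul_pow, ← sq_abs]
  exact pow_le_pow_left₀ (abs_nonneg _) (abs_expect_mul_le hν f g) 2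

lemma abs_expect_le_l2norm (hν : ∀ a, 0 ≤ ν a) (h1 : ∑ a, ν a = 1) (f : α → ℝ) :
    |expect ν f| ≤ l2norm ν f := by
  have := abs_expect_mul_le hν f 1
  rwa [mul_one, show l2norm ν 1 = 1 by simp [l2norm, expect, h1], mul_one] at this

lemma variance_le (h1 : ∑ a, ν a = 1) (f : α → ℝ) :
    variance ν f ≤ expect ν (f ^ 2) := by
  have : (fun a => (f a - expect ν f) ^ 2)
      = f ^ 2 - (2 * expect ν f) • f + fun _ => expect ν f ^ 2 := by
    ext a
    simp only [Pi.add_apply, Pi.sub_apply, Pi.pow_apply, Pi.smul_apply, smul_eq_mul]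
    ring
  rw [variance, this, expect_add, expect_sub, expect_smul, expect_const h1]
  nlinarith [sq_nonneg (expect ν f)]

lemma variance_nonneg (hν : ∀ a, 0 ≤ ν a) (f : α → ℝ) : 0 ≤ variance ν f :=
  expect_nonneg hν fun _ _ => sq_nonneg _

/-- Used to trade one factor of a square for a pointwise bound, which keeps the error terms
quadratic in `l2norm ν f` rather than quartic. -/
lemma l2norm_sq_le (hν : ∀ a, 0 ≤ ν a) {M : ℝ} (hM : 0 ≤ M) (H : ∀ a, ν a ≠ 0 → |f a| ≤ M) :
    l2norm ν (f ^ 2) ≤ M * l2norm ν f := by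
  refine (sq_le_sq₀ (l2norm_nonneg _ _) (mul_nonneg hM (l2norm_nonneg _ _))).1 ?_
  rw [mul_pow, l2norm_sq hν, l2norm_sq hν, ← expect_smul]
  refine expect_mono hν fun a ha => ?_
  have := sq_le_sq' (by linarith [abs_le.1 (H a ha)]) (abs_le.1 (H a ha)).2
  simp only [Pi.pow_apply, Pi.smul_apply, smul_eq_mul]
  nlinarith [sq_nonneg (f a)]

end Expectation

/-! ### Links and the averaging operators. -/

section Averages

variable {k : ℕ} {V : Fin k → Type u} [∀ i, Fintype (V i)]
  {μ : (∀ i, V i) → ℝ} {S T R : Finset (Fin k)} {f g : (∀ i, V i) → ℝ} {x y : ∀ i, V i}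

open scoped Classical in
/-- The indicator of the tuples that agree with `x` on `S`. -/
def cylinder (S : Finset (Fin k)) (x y : ∀ i, V i) : ℝ := if ∀ i ∈ S, y i = x i then 1 else 0

omit [∀ i, Fintype (V i)] in
lemma cylinder_comm (S : Finset (Fin k)) (x y : ∀ i, V i) : cylinder S x y = cylinder S y x := by
  unfold cylinder
  congr 1
  exact propext ⟨fun h i hi => (h i hi).symm, fun h i hi => (h i hi).symm⟩

omit [∀ i, Fintype (V i)] in
lemma cylinder_of_agree (h : ∀ i ∈ S, y i = x i) : cylinder S x y = 1 := if_pos h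

omit [∀ i, Fintype (V i)] in
lemma agree_of_cylinder_ne_zero (h : cylinder S x y ≠ 0) : ∀ i ∈ S, y i = x i := by
  by_contra h'
  exact h (if_neg h')

omit [∀ i, Fintype (V i)] in
lemma cylinder_nonneg (S : Finset (Fin k)) (x y : ∀ i, V i) : 0 ≤ cylinder S x y := by
  unfold cylinder; split_ifs <;> norm_num

omit [∀ i, Fintype (V i)] in
lemma cylinder_congr (h : ∀ i ∈ S, y i = x i) (z : ∀ i, V i) : cylinder S y z = cylinder S x z := by
  unfold cylinder
  congr 1
  exact propext ⟨fun H i hi => (H i hi).trans (h i hi), fun H i hi => (H i hi).trans (h i hi).symm⟩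

omit [∀ i, Fintype (V i)] in
lemma cylinder_union (S T : Finset (Fin k)) (x y : ∀ i, V i) :
    cylinder (S ∪ T) x y = cylinder S x y * cylinder T x y := by
  unfold cylinder
  by_cases hS : ∀ i ∈ S, y i = x i <;> by_cases hT : ∀ i ∈ T, y i = x i
  · rw [if_pos hS, if_pos hT, if_pos, one_mul]
    exact fun i hi => (Finset.mem_union.1 hi).elim (hS i) (hT i)
  · rw [if_neg hT, if_neg, mul_zero]
    exact fun H => hT fun i hi => H i (Finset.mem_union_right _ hi)
  · rw [if_neg hS, if_neg, zero_mul]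
    exact fun H => hS fun i hi => H i (Finset.mem_union_left _ hi)
  · rw [if_neg hS, if_neg, zero_mul]
    exact fun H => hS fun i hi => H i (Finset.mem_union_left _ hi)

lemma marginal_eq (μ : (∀ i, V i) → ℝ) (S : Finset (Fin k)) (x : ∀ i, V i) :
    marginal μ S x = ∑ y, cylinder S x y * μ y := by
  simp [marginal, cylinder]

lemma link_apply (μ : (∀ i, V i) → ℝ) (S : Finset (Fin k)) (x y : ∀ i, V i) :
    link μ S x y = cylinder S x y * μ y / marginal μ S x := by
  simp [link, cylinder]

lemma average_eq (μ : (∀ i, V i) → ℝ) (S : Finset (Fin k)) (f : (∀ i, V i) → ℝ) (x : ∀ i, V i) :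
    average μ S f x = expect μ (cylinder S x * f) / marginal μ S x := by
  simp only [average, expect, link_apply, Finset.sum_div, Pi.mul_apply]
  exact Finset.sum_congr rfl fun _ _ => by ring

lemma marginal_nonneg (hμ : ∀ x, 0 ≤ μ x) (S : Finset (Fin k)) (x : ∀ i, V i) :
    0 ≤ marginal μ S x := by
  rw [marginal_eq]
  exact Finset.sum_nonneg fun y _ => mul_nonneg (cylinder_nonneg _ _ _) (hμ y)

lemma marginal_pos (hμ : ∀ x, 0 ≤ μ x) (hy : μ y ≠ 0) (h : ∀ i ∈ S, y i = x i) :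
    0 < marginal μ S x := by
  rw [marginal_eq]
  refine lt_of_lt_of_le ?_ (Finset.single_le_sum (f := fun y => cylinder S x y * μ y)
    (fun y _ => mul_nonneg (cylinder_nonneg _ _ _) (hμ y)) (Finset.mem_univ y))
  simpa [cylinder_of_agree h] using lt_of_le_of_ne (hμ y) hy.symm

lemma marginal_pos_self (hμ : ∀ x, 0 ≤ μ x) (hx : μ x ≠ 0) (S : Finset (Fin k)) :
    0 < marginal μ S x := marginal_pos hμ hx fun _ _ => rfl

lemma exists_of_marginal_ne_zero (h : marginal μ S x ≠ 0) :
    ∃ y, μ y ≠ 0 ∧ ∀ i ∈ S, y i = x i := by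
  rw [marginal_eq] at h
  obtain ⟨y, -, hy⟩ := Finset.exists_ne_zero_of_sum_ne_zero h
  exact ⟨y, right_ne_zero_of_mul hy, agree_of_cylinder_ne_zero (left_ne_zero_of_mul hy)⟩

lemma marginal_congr (μ : (∀ i, V i) → ℝ) (h : ∀ i ∈ S, y i = x i) :
    marginal μ S y = marginal μ S x := by
  simp only [marginal_eq, cylinder_congr h]

lemma link_congr (μ : (∀ i, V i) → ℝ) (h : ∀ i ∈ S, y i = x i) : link μ S y = link μ S x := by
  ext z
  simp only [link_apply, cylinder_congr h, marginal_congr μ h]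

lemma link_nonneg (hμ : ∀ x, 0 ≤ μ x) (S : Finset (Fin k)) (x y : ∀ i, V i) :
    0 ≤ link μ S x y := by
  rw [link_apply]
  exact div_nonneg (mul_nonneg (cylinder_nonneg _ _ _) (hμ y)) (marginal_nonneg hμ S x)

lemma link_sum (h : marginal μ S x ≠ 0) : ∑ y, link μ S x y = 1 := by
  simp only [link_apply, ← Finset.sum_div, ← marginal_eq, div_self h]

lemma of_link_ne_zero (h : link μ S x y ≠ 0) : μ y ≠ 0 ∧ ∀ i ∈ S, y i = x i := by
  rw [link_apply] at h
  have := left_ne_zero_of_mul (div_eq_mul_inv (cylinder S x y * μ y) _ ▸ h)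
  exact ⟨right_ne_zero_of_mul this, agree_of_cylinder_ne_zero (left_ne_zero_of_mul this)⟩

lemma marginal_link (μ : (∀ i, V i) → ℝ) (S T : Finset (Fin k)) (h : ∀ i ∈ S, y i = x i) :
    marginal (link μ S x) T y = marginal μ (S ∪ T) y / marginal μ S x := by
  simp only [marginal_eq, Finset.sum_div, link_apply, cylinder_union, cylinder_congr h]
  exact Finset.sum_congr rfl fun _ _ => by ring

lemma link_link (hx : marginal μ S x ≠ 0) (T : Finset (Fin k)) (h : ∀ i ∈ S, y i = x i) :
    link (link μ S x) T y = link μ (S ∪ T) y := by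
  ext z
  rw [link_apply, marginal_link μ S T h, link_apply, link_apply, cylinder_union, cylinder_congr h]
  field_simp

omit [∀ i, Fintype (V i)] in
lemma dependsOn_cylinder (h : T ⊆ S) (x : ∀ i, V i) : DependsOn (cylinder T x) (S : Set (Fin k)) := by
  intro y z hyz
  rw [cylinder_comm, cylinder_comm T x]
  exact cylinder_congr (fun i hi => hyz i (h hi)) x

omit [∀ i, Fintype (V i)] in
lemma dependsOn_mono (hf : DependsOn f (S : Set (Fin k))) (h : S ⊆ T) :
    DependsOn f (T : Set (Fin k)) := fun _ _ hxy => hf fun i hi => hxy i (h hi)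

lemma dependsOn_average (μ : (∀ i, V i) → ℝ) (S : Finset (Fin k)) (f : (∀ i, V i) → ℝ) :
    DependsOn (average μ S f) (S : Set (Fin k)) := by
  intro x y h
  simp only [average, link_congr μ (S := S) h]

lemma average_congr (H : ∀ x, μ x ≠ 0 → f x = g x) : average μ S f = average μ S g := by
  ext x
  exact expect_congr fun y hy => H y (of_link_ne_zero hy).1

lemma average_add (μ : (∀ i, V i) → ℝ) (S : Finset (Fin k)) (f g : (∀ i, V i) → ℝ) :
    average μ S (f + g) = average μ S f + average μ S g := funext fun _ => expect_add _ _ _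

lemma average_sub (μ : (∀ i, V i) → ℝ) (S : Finset (Fin k)) (f g : (∀ i, V i) → ℝ) :
    average μ S (f - g) = average μ S f - average μ S g := funext fun _ => expect_sub _ _ _

lemma average_smul (μ : (∀ i, V i) → ℝ) (S : Finset (Fin k)) (c : ℝ) (f : (∀ i, V i) → ℝ) :
    average μ S (c • f) = c • average μ S f := funext fun _ => expect_smul _ _ _

lemma average_sum {ι : Type*} (μ : (∀ i, V i) → ℝ) (S : Finset (Fin k)) (s : Finset ι)
    (F : ι → (∀ i, V i) → ℝ) : average μ S (∑ i ∈ s, F i) = ∑ i ∈ s, average μ S (F i) := by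
  ext x
  simp [average, expect_sum]

lemma average_mul_of_dependsOn (μ : (∀ i, V i) → ℝ) (hg : DependsOn g (S : Set (Fin k)))
    (f : (∀ i, V i) → ℝ) : average μ S (g * f) = g * average μ S f := by
  ext x
  simp only [average, expect, Pi.mul_apply, Finset.mul_sum]
  refine Finset.sum_congr rfl fun y _ => ?_
  by_cases hy : link μ S x y = 0
  · simp [hy]
  · rw [hg (of_link_ne_zero hy).2]; ring

lemma expect_average (hμ : ∀ x, 0 ≤ μ x) (S : Finset (Fin k)) (f : (∀ i, V i) → ℝ) :
    expect μ (average μ S f) = expect μ f := by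
  unfold expect
  simp only [average_eq, expect, Pi.mul_apply, Finset.sum_div, Finset.mul_sum]
  rw [Finset.sum_comm]
  refine Finset.sum_congr rfl fun y _ => ?_
  by_cases hy : μ y = 0
  · simp [hy]
  have hm := (marginal_pos_self hμ hy S).ne'
  -- The cylinder relation is symmetric and the marginal is constant on each class, so the sum over
  -- `x` reproduces `marginal μ S y` and cancels the denominator.
  have : ∀ x, μ x * (μ y * (cylinder S x y * f y) / marginal μ S x)
      = (cylinder S y x * μ x) * (μ y * f y / marginal μ S y) := by
    intro x
    by_cases hc : cylinder S x y = 0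
    · simp [hc, cylinder_comm S y x]
    · rw [marginal_congr μ (agree_of_cylinder_ne_zero hc), cylinder_comm S y x]; ring
  simp only [this, ← Finset.sum_mul, ← marginal_eq]
  field_simp

lemma expect_mul_average (hμ : ∀ x, 0 ≤ μ x) (hg : DependsOn g (S : Set (Fin k)))
    (f : (∀ i, V i) → ℝ) : expect μ (g * average μ S f) = expect μ (g * f) := by
  rw [← average_mul_of_dependsOn μ hg, expect_average hμ]

lemma expect_mul_average_comm (hμ : ∀ x, 0 ≤ μ x) (S : Finset (Fin k)) (f g : (∀ i, V i) → ℝ) :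
    expect μ (g * average μ S f) = expect μ (average μ S g * f) := by
  rw [← expect_mul_average hμ (dependsOn_average μ S g), mul_comm g,
    ← expect_mul_average hμ (dependsOn_average μ S f), mul_comm]

lemma average_eq_self (hμ : ∀ x, 0 ≤ μ x) (hf : DependsOn f (S : Set (Fin k))) (hx : μ x ≠ 0) :
    average μ S f x = f x := by
  have h := average_mul_of_dependsOn μ hf 1
  rw [mul_one] at h
  rw [h, Pi.mul_apply, average]
  simp [expect, link_sum (marginal_pos_self hμ hx S).ne']

lemma average_average_of_subset (hμ : ∀ x, 0 ≤ μ x) (h : T ⊆ S) (f : (∀ i, V i) → ℝ) :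
    average μ T (average μ S f) = average μ T f := by
  ext x
  rw [average_eq, average_eq, expect_mul_average hμ (dependsOn_cylinder h x)]

lemma average_average_of_superset (hμ : ∀ x, 0 ≤ μ x) (h : T ⊆ S) (f : (∀ i, V i) → ℝ)
    (hx : μ x ≠ 0) : average μ S (average μ T f) x = average μ T f x :=
  average_eq_self hμ (dependsOn_mono (dependsOn_average μ T f) h) hx

lemma average_univ (hμ : ∀ x, 0 ≤ μ x) (f : (∀ i, V i) → ℝ) (hx : μ x ≠ 0) :
    average μ Finset.univ f x = f x :=
  average_eq_self hμ (fun y z h => by rw [funext fun i => h i (by simp)]) hx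

lemma l2norm_average_le (hμ : ∀ x, 0 ≤ μ x) (S : Finset (Fin k)) (f : (∀ i, V i) → ℝ) :
    l2norm μ (average μ S f) ≤ l2norm μ f := by
  have h : l2norm μ (average μ S f) ^ 2 ≤ l2norm μ (average μ S f) * l2norm μ f := by
    rw [l2norm_sq hμ, sq, expect_mul_average hμ (dependsOn_average μ S f)]
    exact expect_mul_le hμ _ _
  by_contra! hlt
  nlinarith [l2norm_nonneg μ f]

lemma expect_mul_sub_average (hμ : ∀ x, 0 ≤ μ x) (hg : DependsOn g (S : Set (Fin k)))
    (f : (∀ i, V i) → ℝ) : expect μ (g * (f - average μ S f)) = 0 := by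
  rw [mul_sub, expect_sub, expect_mul_average hμ hg, sub_self]

lemma l2norm_sub_average_le (hμ : ∀ x, 0 ≤ μ x) (S : Finset (Fin k)) (f : (∀ i, V i) → ℝ) :
    l2norm μ (f - average μ S f) ≤ l2norm μ f := by
  refine (sq_le_sq₀ (l2norm_nonneg _ _) (l2norm_nonneg _ _)).1 ?_
  have h0 := expect_mul_sub_average hμ (dependsOn_average μ S f) f
  have : f ^ 2 = (f - average μ S f) ^ 2 + average μ S f ^ 2
      + (2 : ℝ) • (average μ S f * (f - average μ S f)) := by
    ext x
    simp only [Pi.add_apply, Pi.sub_apply, Pi.pow_apply, Pi.smul_apply, Pi.mul_apply, smul_eq_mul]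
    ring
  rw [l2norm_sq hμ, l2norm_sq hμ, this, expect_add, expect_add, expect_smul, h0]
  linarith [expect_sq_nonneg hμ (average μ S f)]

lemma abs_average_le (hμ : ∀ x, 0 ≤ μ x) {M : ℝ} (H : ∀ x, μ x ≠ 0 → |f x| ≤ M)
    (hx : μ x ≠ 0) : |average μ S f x| ≤ M := by
  have h1 := link_sum (marginal_pos_self hμ hx S).ne'
  have hl := link_nonneg hμ S x
  rw [← expect_const h1 M, average, abs_le]
  constructor
  · rw [neg_eq_neg_one_mul, ← expect_smul]
    refine expect_mono hl fun y hy => ?_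
    simpa using (abs_le.1 (H y (of_link_ne_zero hy).1)).1
  · exact expect_mono hl fun y hy => (abs_le.1 (H y (of_link_ne_zero hy).1)).2

end Averages

/-! ### Approximate commutation of averages in an ε-product measure. -/

section Commutation

variable {k : ℕ} {V : Fin k → Type u} [∀ i, Fintype (V i)]
  {μ : (∀ i, V i) → ℝ} {ε : ℝ} {S T R : Finset (Fin k)} {f g : (∀ i, V i) → ℝ} {x y : ∀ i, V i}

lemma expect_skeleton (ν : (∀ i, V i) → ℝ) (i j : Fin k) (F : V i × V j → ℝ) :
    expect (skeleton ν i j) F = expect ν fun y => F (y i, y j) := by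
  classical
  simp only [expect, skeleton, Finset.sum_mul]
  rw [Finset.sum_comm]
  refine Finset.sum_congr rfl fun y _ => ?_
  rw [Finset.sum_eq_single (y i, y j)]
  · simp
  · rintro ⟨a, b⟩ - h
    rw [if_neg, zero_mul]
    rintro ⟨rfl, rfl⟩
    exact h rfl
  · simp

/-- On the link of `x_S` the function `f` depends on coordinate `i` only and `g` on coordinate `j`
only, so this is pseudorandomness of the projection to these two coordinates. -/
lemma IsEpsProduct.abs_link_covariance_le (hμ : ∀ x, 0 ≤ μ x) (hε : 0 ≤ ε)
    (hp : IsEpsProduct ε μ) {i j : Fin k} (hij : i ≠ j) (hi : i ∉ S) (hj : j ∉ S)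
    (hf : DependsOn f (insert i S : Finset (Fin k))) (hg : DependsOn g (insert j S : Finset (Fin k)))
    (hx : marginal μ S x ≠ 0) :
    |average μ S (f * g) x - average μ S f x * average μ S g x|
      ≤ ε * (l2norm (link μ S x) f * l2norm (link μ S x) g) := by
  have hcard : S.card + 2 ≤ k := by
    have := Finset.card_le_univ (insert i (insert j S))
    rwa [Finset.card_insert_of_notMem (by simp [hij, hi]), Finset.card_insert_of_notMem hj,
      Fintype.card_fin] at this
  have hl := link_nonneg hμ S x
  have h1 := link_sum hx
  have key := hp S hcard x (lt_of_le_of_ne (marginal_nonneg hμ S x) hx.symm) i j hi hj hij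
    (fun a => f (Function.update x i a)) (fun b => g (Function.update x j b))
  have ef : ∀ y, link μ S x y ≠ 0 → f (Function.update x i (y i)) = f y := by
    intro y hy
    refine hf fun m hm => ?_
    rcases Finset.mem_insert.1 hm with rfl | hm'
    · simp
    · rw [Function.update_of_ne (by rintro rfl; exact hi hm'), (of_link_ne_zero hy).2 m hm']
  have eg : ∀ y, link μ S x y ≠ 0 → g (Function.update x j (y j)) = g y := by
    intro y hy
    refine hg fun m hm => ?_
    rcases Finset.mem_insert.1 hm with rfl | hm'
    · simp
    · rw [Function.update_of_ne (by rintro rfl; exact hj hm'), (of_link_ne_zero hy).2 m hm']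
  simp only [variance, expect_skeleton] at key
  rw [expect_congr (ν := link μ S x) (f := fun y => f (Function.update x i (y i)) * _) (g := f * g)
      fun y hy => by rw [ef y hy, eg y hy]; rfl,
    expect_congr (ν := link μ S x) (g := f) ef, expect_congr (ν := link μ S x) (g := g) eg,
    expect_congr (ν := link μ S x) (f := fun y => (f (Function.update x i (y i)) - _) ^ 2)
      (g := fun y => (f y - expect (link μ S x) f) ^ 2) fun y hy => by rw [ef y hy],
    expect_congr (ν := link μ S x) (f := fun y => (g (Function.update x j (y j)) - _) ^ 2)
      (g := fun y => (g y - expect (link μ S x) g) ^ 2) fun y hy => by rw [eg y hy]] at key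
  refine key.trans (mul_le_mul_of_nonneg_left ?_ hε)
  change √(variance _ _ * variance _ _) ≤ _
  rw [l2norm, l2norm, ← Real.sqrt_mul (show 0 ≤ expect (link μ S x) fun a => f a ^ 2
    from expect_sq_nonneg hl f)]
  exact Real.sqrt_le_sqrt (mul_le_mul (variance_le h1 f) (variance_le h1 g)
    (variance_nonneg hl g) (expect_sq_nonneg hl f))

/-- Lets a bound that holds in each link be integrated over `x` by Cauchy–Schwarz. -/
lemma l2norm_l2norm_link (hμ : ∀ x, 0 ≤ μ x) (S : Finset (Fin k)) (f : (∀ i, V i) → ℝ) :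
    l2norm μ (fun x => l2norm (link μ S x) f) = l2norm μ f := by
  have : (fun x => l2norm (link μ S x) f) ^ 2 = average μ S (f ^ 2) := by
    ext x
    exact l2norm_sq (link_nonneg hμ S x) f
  rw [l2norm, l2norm]
  change √(expect μ ((fun x => l2norm (link μ S x) f) ^ 2)) = _
  rw [this, expect_average hμ]
  rfl

/-- The difference `w` is tested against itself: `‖w‖²` is the mean over `x_S` of the covariance, in
the link, of a function of coordinate `i` and one of coordinate `j`. This is at most `ε ‖h‖ ‖w‖`,
and one factor `‖w‖` cancels. -/
lemma IsEpsProduct.average_average_insert (hμ : ∀ x, 0 ≤ μ x) (hε : 0 ≤ ε)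
    (hp : IsEpsProduct ε μ) {i j : Fin k} (hij : i ≠ j) (hi : i ∉ S) (hj : j ∉ S)
    (f : (∀ i, V i) → ℝ) :
    l2norm μ (average μ (insert j S) (average μ (insert i S) f) - average μ S f)
      ≤ ε * l2norm μ f := by
  set h := average μ (insert i S) f with hh
  have hSi : S ⊆ insert i S := Finset.subset_insert _ _
  have hSj : S ⊆ insert j S := Finset.subset_insert _ _
  have e1 : average μ S h = average μ S f := average_average_of_subset hμ hSi f
  rw [← e1]
  set w := average μ (insert j S) h - average μ S h with hw
  have hwd : DependsOn w (insert j S : Finset (Fin k)) := fun y z hyz => by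
    simp only [hw, Pi.sub_apply]
    rw [dependsOn_average μ _ h hyz, dependsOn_mono (dependsOn_average μ S h) hSj hyz]
  have e2 : expect μ (w ^ 2) = expect μ (average μ S (h * w) - average μ S h * average μ S w) := by
    rw [expect_sub, expect_average hμ, expect_mul_average hμ (dependsOn_average μ S h),
      sq, mul_comm h w, mul_comm (average μ S h) w, ← expect_sub, ← mul_sub]
    nth_rw 2 [hw]
    rw [mul_sub, expect_sub, expect_mul_average hμ hwd, ← expect_sub, ← mul_sub]
  have e3 : l2norm μ w ^ 2 ≤ ε * (l2norm μ h * l2norm μ w) := by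
    have := expect_mul_le hμ (fun x => l2norm (link μ S x) h) (fun x => l2norm (link μ S x) w)
    rw [l2norm_l2norm_link hμ, l2norm_l2norm_link hμ] at this
    refine le_trans ?_ (mul_le_mul_of_nonneg_left this hε)
    rw [l2norm_sq hμ, e2, ← expect_smul]
    exact expect_mono hμ fun x hx => (le_abs_self _).trans
      (hp.abs_link_covariance_le hμ hε hij hi hj (dependsOn_average μ _ f) hwd
        (marginal_pos_self hμ hx S).ne')
  have e4 : l2norm μ h ≤ l2norm μ f := l2norm_average_le hμ _ f
  by_contra! hlt
  have hw0 : 0 < l2norm μ w := lt_of_le_of_lt (mul_nonneg hε (l2norm_nonneg _ _)) hlt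
  have := mul_le_mul_of_nonneg_left e4 hε
  nlinarith

lemma IsEpsProduct.average_average_union (hμ : ∀ x, 0 ≤ μ x) (hε : 0 ≤ ε)
    (hp : IsEpsProduct ε μ) {t : Fin k} (P : Finset (Fin k)) (hP : Disjoint S P) (htS : t ∉ S)
    (htP : t ∉ P) (f : (∀ i, V i) → ℝ) :
    l2norm μ (average μ (S ∪ P) (average μ (insert t S) f) - average μ S f)
      ≤ P.card * ε * l2norm μ f := by
  induction P using Finset.induction_on with
  | empty =>
    rw [Finset.union_empty, average_average_of_subset hμ (Finset.subset_insert _ _), sub_self]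
    simp [l2norm_zero]
  | insert p P hpP ih =>
    rw [Finset.disjoint_insert_right] at hP
    rw [Finset.mem_insert, not_or] at htP
    -- Inserting the average on `insert t (S ∪ P)` changes nothing on the support, and puts the
    -- one-coordinate estimate over the base `S ∪ P` within reach.
    have e1 : average μ (S ∪ insert p P) (average μ (insert t S) f)
        = average μ (insert p (S ∪ P)) (average μ (insert t (S ∪ P))
          (average μ (insert t S) f)) := by
      rw [Finset.union_insert]
      refine average_congr fun x hx => (average_average_of_superset hμ ?_ f hx).symm
      exact Finset.insert_subset_insert _ Finset.subset_union_left
    have h1 := hp.average_average_insert hμ hε (S := S ∪ P) (i := t) (j := p) htP.1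
      (by simp [htS, htP.2]) (by simp [hP.1, hpP]) (average μ (insert t S) f)
    have h2 := l2norm_average_le hμ (insert t S) f
    have h3 := l2norm_add_le hμ
      (average μ (insert p (S ∪ P)) (average μ (insert t (S ∪ P)) (average μ (insert t S) f))
        - average μ (S ∪ P) (average μ (insert t S) f))
      (average μ (S ∪ P) (average μ (insert t S) f) - average μ S f)
    rw [sub_add_sub_cancel, ← e1] at h3
    rw [← e1] at h1
    have h4 := mul_le_mul_of_nonneg_left h2 hε
    have h5 := ih hP.2 htP.2
    rw [Finset.card_insert_of_notMem hpP]
    push_cast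
    linarith

lemma IsEpsProduct.average_average_disjoint (hμ : ∀ x, 0 ≤ μ x) (hε : 0 ≤ ε)
    (hp : IsEpsProduct ε μ) (P Q : Finset (Fin k)) (hP : Disjoint S P) (hQ : Disjoint S Q)
    (hPQ : Disjoint P Q) (f : (∀ i, V i) → ℝ) :
    l2norm μ (average μ (S ∪ P) (average μ (S ∪ Q) f) - average μ S f)
      ≤ Q.card * (P.card * ε) * l2norm μ f := by
  induction Q using Finset.induction_on with
  | empty =>
    rw [Finset.union_empty, l2norm_congr (g := 0)]
    · simp [l2norm_zero]
    · intro x hx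
      simp [average_average_of_superset hμ Finset.subset_union_left f hx]
  | insert t Q ht ih =>
    rw [Finset.disjoint_insert_right] at hQ hPQ
    -- By the tower property an average on `S ∪ Q ∪ P` may be inserted; the previous lemma over the
    -- base `S ∪ Q` then removes `t`.
    have e1 : average μ (S ∪ P) (average μ (S ∪ insert t Q) f)
        = average μ (S ∪ P) (average μ (S ∪ Q ∪ P) (average μ (insert t (S ∪ Q)) f)) := by
      rw [average_average_of_subset hμ (Finset.union_subset_union_left Finset.subset_union_left),
        Finset.union_insert]
    have h1 := hp.average_average_union hμ hε (S := S ∪ Q) (t := t) P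
      (Finset.disjoint_union_left.2 ⟨hP, hPQ.2.symm⟩) (by simp [hQ.1, ht]) hPQ.1 f
    have h2 := (l2norm_average_le hμ (S ∪ P) _).trans h1
    rw [average_sub] at h2
    have h3 := l2norm_add_le hμ
      (average μ (S ∪ P) (average μ (S ∪ Q ∪ P) (average μ (insert t (S ∪ Q)) f))
        - average μ (S ∪ P) (average μ (S ∪ Q) f))
      (average μ (S ∪ P) (average μ (S ∪ Q) f) - average μ S f)
    rw [sub_add_sub_cancel, ← e1] at h3
    rw [← e1] at h2
    have h5 := ih hQ.2 hPQ.2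
    rw [Finset.card_insert_of_notMem ht]
    push_cast
    linarith

/-- In an `ε`-product measure `A_S A_T` is close to `A_{S ∩ T}`. -/
lemma IsEpsProduct.average_average_inter (hμ : ∀ x, 0 ≤ μ x) (hε : 0 ≤ ε)
    (hp : IsEpsProduct ε μ) (S T : Finset (Fin k)) (f : (∀ i, V i) → ℝ) :
    l2norm μ (average μ S (average μ T f) - average μ (S ∩ T) f)
      ≤ (k : ℝ) ^ 2 * ε * l2norm μ f := by
  have h := hp.average_average_disjoint hμ hε (S := S ∩ T) (S \ T) (T \ S)
    (by rw [Finset.disjoint_left]; grind) (by rw [Finset.disjoint_left]; grind)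
    (by rw [Finset.disjoint_left]; grind) f
  rw [show S ∩ T ∪ S \ T = S by grind, show S ∩ T ∪ T \ S = T by grind] at h
  refine h.trans (mul_le_mul_of_nonneg_right ?_ (l2norm_nonneg _ _))
  have h1 : ((S \ T).card : ℝ) ≤ k := by exact_mod_cast card_finset_fin_le _
  have h2 : ((T \ S).card : ℝ) ≤ k := by exact_mod_cast card_finset_fin_le _
  calc ((T \ S).card : ℝ) * ((S \ T).card * ε) ≤ k * (k * ε) := by gcongr
    _ = _ := by ring

end Commutation

/-! ### Near-orthogonality of the Efron–Stein components. -/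

section EfronStein

variable {k : ℕ} {V : Fin k → Type u} [∀ i, Fintype (V i)]
  {μ : (∀ i, V i) → ℝ} {ε : ℝ} {S T R : Finset (Fin k)} {f g : (∀ i, V i) → ℝ} {x y : ∀ i, V i}

lemma efronStein_eq (μ : (∀ i, V i) → ℝ) (S : Finset (Fin k)) (f : (∀ i, V i) → ℝ) :
    efronStein μ S f = ∑ T ∈ S.powerset, (-1 : ℝ) ^ (S \ T).card • average μ T f := by
  ext x
  simp [efronStein]

lemma lowDegree_eq (μ : (∀ i, V i) → ℝ) (d : ℕ) (f : (∀ i, V i) → ℝ) :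
    lowDegree μ d f = ∑ S : Finset (Fin k) with S.card ≤ d, efronStein μ S f := by
  ext x
  simp [lowDegree]

lemma dependsOn_efronStein (μ : (∀ i, V i) → ℝ) (S : Finset (Fin k)) (f : (∀ i, V i) → ℝ) :
    DependsOn (efronStein μ S f) (S : Set (Fin k)) := by
  intro y z h
  simp only [efronStein]
  refine Finset.sum_congr rfl fun T hT => ?_
  rw [dependsOn_mono (dependsOn_average μ T f) (Finset.mem_powerset.1 hT) h]

lemma sum_powerset_le {T : Finset (Fin k)} {F : Finset (Fin k) → ℝ} {c : ℝ} (hc : 0 ≤ c)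
    (H : ∀ R ∈ T.powerset, F R ≤ c) : ∑ R ∈ T.powerset, F R ≤ 2 ^ k * c := by
  refine (Finset.sum_le_card_nsmul _ _ _ H).trans ?_
  rw [nsmul_eq_mul, Finset.card_powerset]
  push_cast
  gcongr
  · norm_num
  · exact card_finset_fin_le T

lemma abs_neg_one_pow_smul (n : ℕ) (a : ℝ) : |(-1 : ℝ) ^ n * a| = |a| := by
  rw [abs_mul, abs_pow, abs_neg, abs_one, one_pow, one_mul]

lemma l2norm_efronStein_le (hμ : ∀ x, 0 ≤ μ x) (S : Finset (Fin k)) (f : (∀ i, V i) → ℝ) :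
    l2norm μ (efronStein μ S f) ≤ 2 ^ k * l2norm μ f := by
  rw [efronStein_eq]
  refine (l2norm_sum_le hμ _ _).trans (sum_powerset_le (l2norm_nonneg _ _) fun T _ => ?_)
  rw [l2norm_smul hμ, abs_pow, abs_neg, abs_one, one_pow, one_mul]
  exact l2norm_average_le hμ T f

/-- Averaging over a coordinate of `T` nearly annihilates the component `f^{=T}`. -/
lemma IsEpsProduct.l2norm_average_efronStein_le (hμ : ∀ x, 0 ≤ μ x) (hε : 0 ≤ ε)
    (hp : IsEpsProduct ε μ) {i : Fin k} (hi : i ∈ T) (f : (∀ i, V i) → ℝ) :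
    l2norm μ (average μ (Finset.univ.erase i) (efronStein μ T f))
      ≤ 2 ^ k * (k ^ 2 * ε * l2norm μ f) := by
  set E := Finset.univ.erase i
  -- If `A_E A_R` were exactly `A_{E ∩ R}`, the terms of `R` and `insert i R` would cancel, having
  -- opposite signs and the same intersection with `E`.
  have hz : ∑ R ∈ T.powerset, (-1 : ℝ) ^ (T \ R).card • average μ (E ∩ R) f = 0 := by
    obtain ⟨T', hi', rfl⟩ : ∃ T', i ∉ T' ∧ insert i T' = T :=
      ⟨T.erase i, Finset.notMem_erase _ _, Finset.insert_erase hi⟩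
    rw [Finset.sum_powerset_insert hi', ← Finset.sum_add_distrib]
    refine Finset.sum_eq_zero fun R hR => ?_
    have hiR : i ∉ R := fun h => hi' (Finset.mem_powerset.1 hR h)
    rw [show insert i T' \ R = insert i (T' \ R) by grind,
      Finset.card_insert_of_notMem (by simp [hi']),
      show insert i T' \ insert i R = T' \ R by grind, show E ∩ insert i R = E ∩ R by grind,
      ← add_smul, pow_succ]
    simp
  have : average μ E (efronStein μ T f) = ∑ R ∈ T.powerset,
      (-1 : ℝ) ^ (T \ R).card • (average μ E (average μ R f) - average μ (E ∩ R) f) := by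
    simp only [smul_sub, Finset.sum_sub_distrib]
    rw [hz, sub_zero, efronStein_eq, average_sum]
    simp only [average_smul]
  rw [this]
  refine (l2norm_sum_le hμ _ _).trans (sum_powerset_le ?_ fun R _ => ?_)
  · have := l2norm_nonneg μ f
    positivity
  · rw [l2norm_smul hμ, abs_pow, abs_neg, abs_one, one_pow, one_mul]
    exact hp.average_average_inter hμ hε _ _ f

lemma average_erase_efronStein (hμ : ∀ x, 0 ≤ μ x) {i : Fin k} (hi : i ∉ T)
    (f : (∀ i, V i) → ℝ) (hx : μ x ≠ 0) :
    average μ (Finset.univ.erase i) (efronStein μ T f) x = efronStein μ T f x :=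
  average_eq_self hμ (dependsOn_mono (dependsOn_efronStein μ T f) (by grind)) hx

lemma sum_superset_neg_one_pow (R : Finset (Fin k)) :
    ∑ T : Finset (Fin k) with R ⊆ T, (-1 : ℝ) ^ (T \ R).card = if R = Finset.univ then 1 else 0 := by
  have h := congrArg (Int.cast : ℤ → ℝ) (Finset.sum_powerset_neg_one_pow_card (x := Rᶜ))
  push_cast at h
  rw [Finset.sum_bij' (t := Rᶜ.powerset) (g := fun Q => (-1 : ℝ) ^ Q.card) (fun T _ => T \ R)
    (fun Q _ => Q ∪ R), h]
  · simp
  all_goals grind [Finset.mem_compl]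

/-- Möbius inversion on subsets: only the average on all coordinates survives, and it is the
identity on the support of `μ`. -/
lemma sum_efronStein (hμ : ∀ x, 0 ≤ μ x) (f : (∀ i, V i) → ℝ) (hx : μ x ≠ 0) :
    (∑ T, efronStein μ T f) x = f x := by
  have : ∑ T, efronStein μ T f = average μ Finset.univ f := by
    simp only [efronStein_eq]
    rw [Finset.sum_comm' (t' := Finset.univ)
      (s' := fun R => Finset.univ.filter fun T => R ⊆ T) (by simp)]
    simp only [← Finset.sum_smul, sum_superset_neg_one_pow]
    simp
  rw [this, average_univ hμ f hx]

lemma IsEpsProduct.abs_expect_efronStein_mul_le (hμ : ∀ x, 0 ≤ μ x) (hε : 0 ≤ ε)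
    (hp : IsEpsProduct ε μ) (hST : S ≠ T) (f : (∀ i, V i) → ℝ) :
    |expect μ (efronStein μ S f * efronStein μ T f)| ≤ 4 ^ k * k ^ 2 * ε * l2norm μ f ^ 2 := by
  -- With `i` in `S` but not in `T`, averaging out `i` fixes the second factor; by self-adjointness
  -- it moves to the first, which it nearly annihilates.
  have main : ∀ {S T : Finset (Fin k)} {i : Fin k}, i ∈ S → i ∉ T →
      |expect μ (efronStein μ S f * efronStein μ T f)| ≤ 4 ^ k * k ^ 2 * ε * l2norm μ f ^ 2 := by
    intro S T i hS hT
    have h1 : expect μ (efronStein μ S f * efronStein μ T f)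
        = expect μ (average μ (Finset.univ.erase i) (efronStein μ S f) * efronStein μ T f) := by
      rw [← expect_mul_average_comm hμ]
      exact expect_congr fun x hx => by
        rw [Pi.mul_apply, Pi.mul_apply, average_erase_efronStein hμ hT f hx]
    rw [h1]
    refine (abs_expect_mul_le hμ _ _).trans ((mul_le_mul
      (hp.l2norm_average_efronStein_le hμ hε hS f) (l2norm_efronStein_le hμ T f)
      (l2norm_nonneg _ _) (by have := l2norm_nonneg μ f; positivity)).trans (le_of_eq ?_))
    rw [show (4 : ℝ) = 2 * 2 by norm_num, mul_pow]
    ring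
  by_cases h : S ⊆ T
  · obtain ⟨i, hT, hS⟩ := Finset.exists_of_ssubset (h.ssubset_of_ne hST)
    rw [mul_comm]
    exact main hT hS
  · obtain ⟨i, hS, hT⟩ := Finset.not_subset.1 h
    exact main hS hT

lemma card_finset_fin (k : ℕ) : ((Finset.univ : Finset (Finset (Fin k))).card : ℝ) = 2 ^ k := by
  simp

lemma sum_finset_fin_le (s : Finset (Finset (Fin k))) {F : Finset (Fin k) → ℝ} {c : ℝ}
    (hc : 0 ≤ c) (H : ∀ R ∈ s, F R ≤ c) : ∑ R ∈ s, F R ≤ 2 ^ k * c := by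
  refine (Finset.sum_le_card_nsmul _ _ _ H).trans ?_
  rw [nsmul_eq_mul, ← card_finset_fin]
  gcongr
  exact Finset.subset_univ s

/-- Approximate Parseval inequality. -/
lemma IsEpsProduct.sum_expect_efronStein_sq_le (hμ : ∀ x, 0 ≤ μ x) (hε : 0 ≤ ε)
    (hp : IsEpsProduct ε μ) (f : (∀ i, V i) → ℝ) :
    ∑ S, expect μ (efronStein μ S f ^ 2) ≤ (1 + 16 ^ k * k ^ 2 * ε) * l2norm μ f ^ 2 := by
  have h1 : l2norm μ f ^ 2 = ∑ S, ∑ T, expect μ (efronStein μ S f * efronStein μ T f) := by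
    rw [l2norm_sq hμ, expect_congr (g := (∑ T, efronStein μ T f) ^ 2)
      fun x hx => by rw [Pi.pow_apply, Pi.pow_apply, sum_efronStein hμ f hx]]
    rw [sq, Finset.sum_mul_sum, expect_sum]
    simp only [expect_sum]
  have h2 : ∀ S, expect μ (efronStein μ S f ^ 2)
      ≤ ∑ T, expect μ (efronStein μ S f * efronStein μ T f)
        + 2 ^ k * (4 ^ k * k ^ 2 * ε * l2norm μ f ^ 2) := by
    intro S
    rw [← Finset.add_sum_erase _ _ (Finset.mem_univ S), ← sq]
    have : -∑ T ∈ Finset.univ.erase S, expect μ (efronStein μ S f * efronStein μ T f)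
        ≤ 2 ^ k * (4 ^ k * k ^ 2 * ε * l2norm μ f ^ 2) := by
      rw [← Finset.sum_neg_distrib]
      refine sum_finset_fin_le _ (by positivity) fun T hT => (neg_le_abs _).trans ?_
      exact hp.abs_expect_efronStein_mul_le hμ hε (Finset.ne_of_mem_erase hT).symm f
    linarith
  refine (Finset.sum_le_sum fun S _ => h2 S).trans (le_of_eq ?_)
  rw [Finset.sum_add_distrib, ← h1, Finset.sum_const, nsmul_eq_mul, card_finset_fin,
    show (16 : ℝ) = 2 * 2 * 4 by norm_num, mul_pow, mul_pow]
  ring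

/-- On the support `f` is `f^{≤d}` plus the components of higher degree, and the latter pair with
`f^{≤d}` only through small inner products of distinct components. -/
lemma IsEpsProduct.l2norm_lowDegree_sq_le (hμ : ∀ x, 0 ≤ μ x) (hε : 0 ≤ ε)
    (hp : IsEpsProduct ε μ) (d : ℕ) (f : (∀ i, V i) → ℝ) :
    l2norm μ (lowDegree μ d f) ^ 2
      ≤ expect μ (lowDegree μ d f * f) + 16 ^ k * k ^ 2 * ε * l2norm μ f ^ 2 := by
  have h1 : expect μ (lowDegree μ d f * f) = expect μ (lowDegree μ d f ^ 2)
      + ∑ S : Finset (Fin k) with S.card ≤ d, ∑ T : Finset (Fin k) with ¬ T.card ≤ d,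
          expect μ (efronStein μ S f * efronStein μ T f) := by
    rw [expect_congr (g := lowDegree μ d f ^ 2 + lowDegree μ d f *
      ∑ T : Finset (Fin k) with ¬ T.card ≤ d, efronStein μ T f), expect_add]
    · rw [lowDegree_eq μ d f, Finset.sum_mul_sum, expect_sum]
      simp only [expect_sum]
    · intro x hx
      rw [Pi.mul_apply, ← sum_efronStein hμ f hx, sq, ← mul_add, Pi.mul_apply,
        lowDegree_eq, Finset.sum_filter_add_sum_filter_not]
  have h2 : -∑ S : Finset (Fin k) with S.card ≤ d, ∑ T : Finset (Fin k) with ¬ T.card ≤ d,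
      expect μ (efronStein μ S f * efronStein μ T f)
        ≤ 2 ^ k * (2 ^ k * (4 ^ k * k ^ 2 * ε * l2norm μ f ^ 2)) := by
    rw [← Finset.sum_neg_distrib]
    refine sum_finset_fin_le _ (by positivity) fun S hS => ?_
    rw [← Finset.sum_neg_distrib]
    refine sum_finset_fin_le _ (by positivity) fun T hT => (neg_le_abs _).trans ?_
    refine hp.abs_expect_efronStein_mul_le hμ hε ?_ f
    rintro rfl
    exact (Finset.mem_filter.1 hT).2 (Finset.mem_filter.1 hS).2
  rw [l2norm_sq hμ]
  have : (2 : ℝ) ^ k * (2 ^ k * (4 ^ k * k ^ 2 * ε * l2norm μ f ^ 2))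
      = 16 ^ k * k ^ 2 * ε * l2norm μ f ^ 2 := by
    rw [show (16 : ℝ) = 2 * 2 * 4 by norm_num, mul_pow, mul_pow]; ring
  linarith

lemma l2norm_lowDegree_le (hμ : ∀ x, 0 ≤ μ x) (d : ℕ) (f : (∀ i, V i) → ℝ) :
    l2norm μ (lowDegree μ d f) ≤ 4 ^ k * l2norm μ f := by
  rw [lowDegree_eq]
  refine (l2norm_sum_le hμ _ _).trans ((sum_finset_fin_le _ (c := 2 ^ k * l2norm μ f)
    (by have := l2norm_nonneg μ f; positivity) fun S _ => l2norm_efronStein_le hμ S f).trans ?_)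
  rw [show (4 : ℝ) = 2 * 2 by norm_num, mul_pow, mul_assoc]

/-- The link of a link is a link of `μ`. A coordinate of `S` is constant there, so its covariance
with anything is zero; if neither coordinate is in `S`, the hypothesis applies to `S ∪ R`. -/
lemma IsEpsProduct.link (hμ : ∀ x, 0 ≤ μ x) (hε : 0 ≤ ε) (hp : IsEpsProduct ε μ)
    (hx : marginal μ S x ≠ 0) : IsEpsProduct ε (link μ S x) := by
  intro R hR y hy i j hi hj hij
  obtain ⟨z, hz, hzy⟩ := exists_of_marginal_ne_zero hy.ne'
  obtain ⟨hz0, hzx⟩ := of_link_ne_zero hz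
  rw [← link_congr (EpsProduct.link μ S x) hzy, link_link hx R hzx]
  have hm := marginal_pos_self hμ hz0 (S ∪ R)
  have hl := link_nonneg hμ (S ∪ R) z
  have h1 := link_sum hm.ne'
  have h0 : ∀ n ∈ S ∪ R, ∀ F : V n → ℝ, ∀ y, EpsProduct.link μ (S ∪ R) z y ≠ 0 → F (y n) = F (z n) :=
    fun n hn F y hy => by rw [(of_link_ne_zero hy).2 n hn]
  by_cases hi' : i ∈ S
  · intro f₁ f₂
    simp only [expect_skeleton]
    rw [expect_congr (ν := EpsProduct.link μ (S ∪ R) z) (f := fun y => f₁ (y i))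
        (h0 i (Finset.mem_union_left _ hi') f₁),
      expect_congr (ν := EpsProduct.link μ (S ∪ R) z) (f := fun y => f₁ (y i) * f₂ (y j))
        (g := f₁ (z i) • fun y => f₂ (y j)) fun y hy => by
          rw [h0 i (Finset.mem_union_left _ hi') f₁ y hy]; rfl, expect_smul, expect_const h1,
      sub_self, abs_zero]
    positivity
  by_cases hj' : j ∈ S
  · intro f₁ f₂
    simp only [expect_skeleton]
    rw [expect_congr (ν := EpsProduct.link μ (S ∪ R) z) (f := fun y => f₂ (y j))
        (h0 j (Finset.mem_union_left _ hj') f₂),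
      expect_congr (ν := EpsProduct.link μ (S ∪ R) z) (f := fun y => f₁ (y i) * f₂ (y j))
        (g := f₂ (z j) • fun y => f₁ (y i)) fun y hy => by
          rw [h0 j (Finset.mem_union_left _ hj') f₂ y hy, mul_comm]; rfl, expect_smul,
      expect_const h1, mul_comm, sub_self, abs_zero]
    positivity
  refine hp (S ∪ R) ?_ z hm i j (by simp [hi, hi']) (by simp [hj, hj']) hij
  have := Finset.card_le_univ (insert i (insert j (S ∪ R)))
  rwa [Finset.card_insert_of_notMem (by simp [hij, hi, hi']),
    Finset.card_insert_of_notMem (by simp [hj, hj']), Fintype.card_fin] at this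

end EfronStein

/-! ### Fourth moments by splitting one coordinate at a time. -/

section Hypercontractivity

variable {k : ℕ} {V : Fin k → Type u} [∀ i, Fintype (V i)]
  {μ : (∀ i, V i) → ℝ} {ε : ℝ} {S T R : Finset (Fin k)} {f g : (∀ i, V i) → ℝ} {x y : ∀ i, V i}

/-- The cross terms that are linear in the `a`'s vanish by hypothesis; every other cross term is
bounded by AM–GM by squares containing some `a₁` or `a₂`. Keeping the coefficient of `b₁² b₂²` equal
to `1` is essential: only coordinates in `S ∪ T` will cost a factor `4`. -/
lemma expect_add_sq_mul_add_sq_le (hμ : ∀ x, 0 ≤ μ x) {b₁ b₂ a₁ a₂ : (∀ i, V i) → ℝ}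
    (h₁ : expect μ (b₁ * b₂ ^ 2 * a₁) = 0) (h₂ : expect μ (b₁ ^ 2 * b₂ * a₂) = 0) :
    expect μ ((b₁ + a₁) ^ 2 * (b₂ + a₂) ^ 2) ≤ expect μ (b₁ ^ 2 * b₂ ^ 2)
      + 4 * expect μ (b₁ ^ 2 * a₂ ^ 2) + 4 * expect μ (a₁ ^ 2 * b₂ ^ 2)
      + 4 * expect μ (a₁ ^ 2 * a₂ ^ 2) := by
  have h : expect μ ((b₁ + a₁) ^ 2 * (b₂ + a₂) ^ 2) ≤ expect μ (b₁ ^ 2 * b₂ ^ 2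
      + (4 : ℝ) • (b₁ ^ 2 * a₂ ^ 2) + (4 : ℝ) • (a₁ ^ 2 * b₂ ^ 2) + (4 : ℝ) • (a₁ ^ 2 * a₂ ^ 2)
      + (2 : ℝ) • (b₁ * b₂ ^ 2 * a₁) + (2 : ℝ) • (b₁ ^ 2 * b₂ * a₂)) := by
    refine expect_mono hμ fun x _ => ?_
    simp only [Pi.add_apply, Pi.mul_apply, Pi.pow_apply, Pi.smul_apply, smul_eq_mul]
    nlinarith [sq_nonneg (a₁ x * b₂ x - b₁ x * a₂ x), sq_nonneg (a₁ x * a₂ x - b₁ x * a₂ x),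
      sq_nonneg (a₁ x * a₂ x - a₁ x * b₂ x), sq_nonneg (a₁ x * a₂ x)]
  simpa only [expect_add, expect_smul, h₁, h₂, mul_zero, add_zero] using h

/-- The part of `f` that is obtained by applying, for each coordinate `i` in the list in turn, the
conditional expectation on the other coordinates if `i ∉ S`, and its complementary projection if
`i ∈ S`. -/
def iteratedPart (μ : (∀ i, V i) → ℝ) (S : Finset (Fin k)) :
    List (Fin k) → ((∀ i, V i) → ℝ) → (∀ i, V i) → ℝ
  | [], f => f
  | i :: L, f => iteratedPart μ S L
      (if i ∈ S then f - average μ (Finset.univ.erase i) f else average μ (Finset.univ.erase i) f)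

lemma iteratedPart_congr_set (μ : (∀ i, V i) → ℝ) {L : List (Fin k)}
    (h : ∀ i ∈ L, i ∈ S ↔ i ∈ T) (f : (∀ i, V i) → ℝ) :
    iteratedPart μ S L f = iteratedPart μ T L f := by
  induction L generalizing f with
  | nil => rfl
  | cons i L ih =>
    rw [iteratedPart, iteratedPart, ih (fun j hj => h j (List.mem_cons_of_mem _ hj))]
    simp only [h i List.mem_cons_self]

lemma iteratedPart_add (μ : (∀ i, V i) → ℝ) (S : Finset (Fin k)) (L : List (Fin k))
    (f g : (∀ i, V i) → ℝ) :
    iteratedPart μ S L (f + g) = iteratedPart μ S L f + iteratedPart μ S L g := by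
  induction L generalizing f g with
  | nil => rfl
  | cons i L ih =>
    rw [iteratedPart, iteratedPart, iteratedPart, ← ih]
    congr 1
    split_ifs
    · rw [average_add, add_sub_add_comm]
    · rw [average_add]

lemma iteratedPart_sum (μ : (∀ i, V i) → ℝ) (S : Finset (Fin k)) (L : List (Fin k)) {ι : Type*}
    (s : Finset ι) (F : ι → (∀ i, V i) → ℝ) :
    iteratedPart μ S L (∑ i ∈ s, F i) = ∑ i ∈ s, iteratedPart μ S L (F i) :=
  map_sum (AddMonoidHom.mk' (iteratedPart μ S L) (iteratedPart_add μ S L)) F s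

lemma l2norm_iteratedPart_le (hμ : ∀ x, 0 ≤ μ x) (S : Finset (Fin k)) (L : List (Fin k))
    (f : (∀ i, V i) → ℝ) : l2norm μ (iteratedPart μ S L f) ≤ l2norm μ f := by
  induction L generalizing f with
  | nil => exact le_rfl
  | cons i L ih =>
    refine (ih _).trans ?_
    split_ifs
    · exact l2norm_sub_average_le hμ _ f
    · exact l2norm_average_le hμ _ f

lemma abs_iteratedPart_le (hμ : ∀ x, 0 ≤ μ x) (S : Finset (Fin k)) (L : List (Fin k)) {M : ℝ}
    (hM : 0 ≤ M) (H : ∀ x, μ x ≠ 0 → |f x| ≤ M) (hx : μ x ≠ 0) :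
    |iteratedPart μ S L f x| ≤ 2 ^ L.length * M := by
  induction L generalizing f M with
  | nil => simpa [iteratedPart] using H x hx
  | cons i L ih =>
    rw [List.length_cons, pow_succ, mul_assoc]
    refine ih (by positivity) fun y hy => ?_
    have h := abs_average_le (S := Finset.univ.erase i) hμ H hy
    split_ifs
    · refine (abs_sub _ _).trans ?_
      linarith [H y hy]
    · linarith

/-- The fourth moment is controlled by the second moments of products of components. No
assumption is made on the measure. -/
lemma expect_sq_mul_sq_le (hμ : ∀ x, 0 ≤ μ x) {L : List (Fin k)} (hL : L.Nodup)
    (f g : (∀ i, V i) → ℝ) :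
    expect μ (f ^ 2 * g ^ 2) ≤ ∑ S ∈ L.toFinset.powerset, ∑ T ∈ L.toFinset.powerset,
      4 ^ (S ∪ T).card * expect μ (iteratedPart μ S L f ^ 2 * iteratedPart μ T L g ^ 2) := by
  induction L generalizing f g with
  | nil => simp [iteratedPart]
  | cons i L ih =>
    obtain ⟨hi, hL⟩ := List.nodup_cons.1 hL
    have hi' : i ∉ L.toFinset := by simpa using hi
    set E := Finset.univ.erase i
    have e0 : ∀ S ∈ L.toFinset.powerset, ∀ h : (∀ i, V i) → ℝ,
        iteratedPart μ S (i :: L) h = iteratedPart μ S L (average μ E h) := by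
      intro S hS h
      rw [iteratedPart, if_neg fun h => hi' (Finset.mem_powerset.1 hS h)]
    have e1 : ∀ S ∈ L.toFinset.powerset, ∀ h : (∀ i, V i) → ℝ,
        iteratedPart μ (insert i S) (i :: L) h = iteratedPart μ S L (h - average μ E h) := by
      intro S hS h
      rw [iteratedPart, if_pos (Finset.mem_insert_self i S)]
      refine iteratedPart_congr_set μ (fun j hj => ?_) _
      simp [ne_of_mem_of_not_mem hj hi]
    have c1 : ∀ S ∈ L.toFinset.powerset, ∀ T ∈ L.toFinset.powerset,
        (4 : ℝ) ^ (insert i (S ∪ T)).card = 4 * 4 ^ (S ∪ T).card := by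
      intro S hS T hT
      rw [Finset.card_insert_of_notMem, pow_succ']
      intro h
      exact hi' (Finset.union_subset (Finset.mem_powerset.1 hS) (Finset.mem_powerset.1 hT) h)
    have d := dependsOn_average μ E
    -- The averages do not depend on coordinate `i`, so a product of them is orthogonal to either
    -- remainder.
    have step := expect_add_sq_mul_add_sq_le hμ (b₁ := average μ E f) (b₂ := average μ E g)
      (a₁ := f - average μ E f) (a₂ := g - average μ E g)
      (expect_mul_sub_average hμ (fun y z h => by simp [d f h, d g h]) f)
      (expect_mul_sub_average hμ (fun y z h => by simp [d f h, d g h]) g)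
    rw [add_sub_cancel, add_sub_cancel] at step
    refine step.trans ?_
    rw [List.toFinset_cons, Finset.sum_powerset_insert hi']
    simp only [Finset.sum_powerset_insert hi']
    simp only [← Finset.sum_add_distrib]
    have h4 : (0 : ℝ) ≤ 4 := by norm_num
    have := add_le_add (add_le_add (add_le_add (ih hL (average μ E f) (average μ E g))
      (mul_le_mul_of_nonneg_left (ih hL (average μ E f) (g - average μ E g)) h4))
      (mul_le_mul_of_nonneg_left (ih hL (f - average μ E f) (average μ E g)) h4))
      (mul_le_mul_of_nonneg_left (ih hL (f - average μ E f) (g - average μ E g)) h4)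
    refine this.trans (le_of_eq ?_)
    simp only [Finset.mul_sum, ← Finset.sum_add_distrib]
    refine Finset.sum_congr rfl fun S hS => Finset.sum_congr rfl fun T hT => ?_
    rw [e0 S hS, e0 T hT, e1 S hS, e1 T hT, Finset.union_insert, Finset.insert_union,
      Finset.insert_union, Finset.union_insert, Finset.insert_idem, c1 S hS T hT]
    ring

/-- At coordinate `i` the projection nearly preserves `f^{=T}` if `S` and `T` agree at `i`, and
nearly kills it otherwise. All projections are contractions in `L²`, so the errors only add up. -/
lemma IsEpsProduct.l2norm_iteratedPart_efronStein_sub_le (hμ : ∀ x, 0 ≤ μ x) (hε : 0 ≤ ε)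
    (hp : IsEpsProduct ε μ) (S T : Finset (Fin k)) (L : List (Fin k)) (f : (∀ i, V i) → ℝ) :
    l2norm μ (iteratedPart μ S L (efronStein μ T f)
        - if ∀ i ∈ L, (i ∈ S ↔ i ∈ T) then efronStein μ T f else 0)
      ≤ L.length * (2 ^ k * (k ^ 2 * ε * l2norm μ f)) := by
  have hη : 0 ≤ 2 ^ k * (k ^ 2 * ε * l2norm μ f) := by
    have := l2norm_nonneg μ f
    positivity
  induction L with
  | nil => simp [iteratedPart, l2norm_zero]
  | cons i L ih =>
    rw [iteratedPart]
    set F := efronStein μ T f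
    set h := if i ∈ S then F - average μ (Finset.univ.erase i) F
      else average μ (Finset.univ.erase i) F with hh
    rw [List.length_cons]
    push_cast
    by_cases hi : i ∈ S ↔ i ∈ T
    · have h1 : l2norm μ (h - F) ≤ 2 ^ k * (k ^ 2 * ε * l2norm μ f) := by
        by_cases hiT : i ∈ T
        · rw [hh, if_pos (hi.2 hiT), sub_sub_cancel_left, l2norm_neg]
          exact hp.l2norm_average_efronStein_le hμ hε hiT f
        · rw [hh, if_neg (mt hi.1 hiT), l2norm_congr (g := 0), l2norm_zero]
          · exact hη
          · intro x hx
            simp [F, average_erase_efronStein hμ hiT f hx]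
      have h2 := (l2norm_iteratedPart_le hμ S L (h - F)).trans h1
      have h3 : iteratedPart μ S L h = iteratedPart μ S L (h - F) + iteratedPart μ S L F := by
        rw [← iteratedPart_add, sub_add_cancel]
      rw [h3, add_sub_assoc]
      refine (l2norm_add_le hμ _ _).trans ?_
      simp only [List.forall_mem_cons, hi, true_and] at ih ⊢
      linarith
    · rw [if_neg fun H => hi (H i List.mem_cons_self), sub_zero]
      refine (l2norm_iteratedPart_le hμ S L h).trans ?_
      have h1 : l2norm μ h ≤ 2 ^ k * (k ^ 2 * ε * l2norm μ f) := by
        by_cases hiT : i ∈ T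
        · rw [hh, if_neg fun H => hi ⟨fun _ => hiT, fun _ => H⟩]
          exact hp.l2norm_average_efronStein_le hμ hε hiT f
        · rw [hh, if_pos (by tauto), l2norm_congr (g := 0), l2norm_zero]
          · exact hη
          · intro x hx
            simp [F, average_erase_efronStein hμ hiT f hx]
      have : 0 ≤ (L.length : ℝ) * (2 ^ k * (k ^ 2 * ε * l2norm μ f)) := by positivity
      linarith

/-- The list runs through all coordinates, so among the components of `f^{≤d}` only `T = S`
survives. -/
lemma IsEpsProduct.l2norm_iteratedPart_lowDegree_sub_le (hμ : ∀ x, 0 ≤ μ x) (hε : 0 ≤ ε)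
    (hp : IsEpsProduct ε μ) (S : Finset (Fin k)) (d : ℕ) (f : (∀ i, V i) → ℝ) :
    l2norm μ (iteratedPart μ S (List.finRange k) (lowDegree μ d f)
        - if S.card ≤ d then efronStein μ S f else 0)
      ≤ 4 ^ k * k ^ 3 * ε * l2norm μ f := by
  have h1 : (if S.card ≤ d then efronStein μ S f else 0)
      = ∑ T : Finset (Fin k) with T.card ≤ d, if S = T then efronStein μ T f else 0 := by
    rw [Finset.sum_ite_eq]
    simp
  rw [h1, lowDegree_eq, iteratedPart_sum, ← Finset.sum_sub_distrib]
  refine (l2norm_sum_le hμ _ _).trans ((sum_finset_fin_le _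
    (c := k * (2 ^ k * (k ^ 2 * ε * l2norm μ f))) (by have := l2norm_nonneg μ f; positivity)
    fun T _ => ?_).trans (le_of_eq ?_))
  · have := hp.l2norm_iteratedPart_efronStein_sub_le hμ hε S T (List.finRange k) f
    simpa only [List.mem_finRange, true_imp_iff, ← Finset.ext_iff, List.length_finRange] using this
  · rw [show (4 : ℝ) = 2 * 2 by norm_num, mul_pow]
    ring

end Hypercontractivity

/-! ### Restriction to links and the fourth moment of a global function. -/

section Global

variable {k : ℕ} {V : Fin k → Type u} [∀ i, Fintype (V i)]
  {μ : (∀ i, V i) → ℝ} {ε δ : ℝ} {d : ℕ} {S T R J I : Finset (Fin k)} {f g : (∀ i, V i) → ℝ}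
  {x y : ∀ i, V i}

/-- The Efron–Stein component on `T` of the restrictions of `f` to the links of the `x_J`. -/
def linkComponent (μ : (∀ i, V i) → ℝ) (J T : Finset (Fin k)) (f : (∀ i, V i) → ℝ) :
    (∀ i, V i) → ℝ :=
  ∑ R ∈ T.powerset, (-1 : ℝ) ^ (T \ R).card • average μ (J ∪ R) f

lemma linkComponent_empty (μ : (∀ i, V i) → ℝ) (T : Finset (Fin k)) (f : (∀ i, V i) → ℝ) :
    linkComponent μ ∅ T f = efronStein μ T f := by
  simp only [linkComponent, Finset.empty_union, efronStein_eq]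

lemma dependsOn_linkComponent (μ : (∀ i, V i) → ℝ) (J T : Finset (Fin k)) (f : (∀ i, V i) → ℝ) :
    DependsOn (linkComponent μ J T f) (J ∪ T : Finset (Fin k)) := by
  intro y z h
  simp only [linkComponent, Finset.sum_apply, Pi.smul_apply]
  refine Finset.sum_congr rfl fun R hR => ?_
  rw [dependsOn_mono (dependsOn_average μ (J ∪ R) f)
    (Finset.union_subset_union_right (Finset.mem_powerset.1 hR)) h]

lemma linkComponent_eq_efronStein_link (hx : marginal μ J x ≠ 0) (T : Finset (Fin k))
    (f : (∀ i, V i) → ℝ) (hy : ∀ i ∈ J, y i = x i) :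
    linkComponent μ J T f y = efronStein (link μ J x) T f y := by
  simp only [linkComponent, efronStein, Finset.sum_apply, Pi.smul_apply, smul_eq_mul, average,
    link_link hx _ hy]

lemma average_linkComponent_sq (hx : marginal μ J x ≠ 0) (T : Finset (Fin k))
    (f : (∀ i, V i) → ℝ) :
    average μ J (linkComponent μ J T f ^ 2) x
      = expect (link μ J x) (efronStein (link μ J x) T f ^ 2) :=
  expect_congr fun y hy => by
    rw [Pi.pow_apply, Pi.pow_apply, linkComponent_eq_efronStein_link hx T f (of_link_ne_zero hy).2]

lemma l2norm_linkComponent_le (hμ : ∀ x, 0 ≤ μ x) (J T : Finset (Fin k)) (f : (∀ i, V i) → ℝ) :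
    l2norm μ (linkComponent μ J T f) ≤ 2 ^ k * l2norm μ f := by
  refine (l2norm_sum_le hμ _ _).trans (sum_powerset_le (l2norm_nonneg _ _) fun R _ => ?_)
  rw [l2norm_smul hμ, abs_pow, abs_neg, abs_one, one_pow, one_mul]
  exact l2norm_average_le hμ _ f

/-- Each `R ⊆ T` splits into `J = R ∩ I` and `R \ I`, and the sign splits accordingly. -/
lemma efronStein_eq_sum_linkComponent (μ : (∀ i, V i) → ℝ) (hI : I ⊆ T) (f : (∀ i, V i) → ℝ) :
    efronStein μ T f
      = ∑ J ∈ I.powerset, (-1 : ℝ) ^ (I \ J).card • linkComponent μ J (T \ I) f := by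
  simp only [efronStein_eq, linkComponent, Finset.smul_sum, smul_smul]
  rw [← Finset.sum_product']
  symm
  refine Finset.sum_bij' (fun p _ => p.1 ∪ p.2) (fun Q _ => (Q ∩ I, Q \ I)) ?_ ?_ ?_ ?_ ?_
  · grind
  · grind
  · rintro ⟨P, Q⟩ h
    simp only [Finset.mem_product, Finset.mem_powerset] at h
    ext <;> grind
  · grind
  · rintro ⟨P, Q⟩ h
    simp only [Finset.mem_product, Finset.mem_powerset] at h ⊢
    rw [← pow_add, ← Finset.card_union_of_disjoint (by rw [Finset.disjoint_left]; grind),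
      show I \ P ∪ (T \ I) \ Q = T \ (P ∪ Q) by grind]

lemma efronStein_sq_le (μ : (∀ i, V i) → ℝ) (hI : I ⊆ T) (f : (∀ i, V i) → ℝ) (x : ∀ i, V i) :
    efronStein μ T f x ^ 2 ≤ 2 ^ I.card * ∑ J ∈ I.powerset, linkComponent μ J (T \ I) f x ^ 2 := by
  rw [efronStein_eq_sum_linkComponent μ hI, Finset.sum_apply]
  refine sq_sum_le_card_mul_sum_sq.trans (le_of_eq ?_)
  rw [Finset.card_powerset]
  push_cast
  congr 1
  refine Finset.sum_congr rfl fun J _ => ?_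
  rw [Pi.smul_apply, smul_eq_mul, mul_pow, ← pow_mul, mul_comm _ 2, pow_mul]
  simp

lemma IsGlobal.abs_average_le (hμ : ∀ x, 0 ≤ μ x) (hg : IsGlobal μ d δ f) (hS : S.card ≤ d)
    (hx : marginal μ S x ≠ 0) : |average μ S f x| ≤ δ :=
  (abs_expect_le_l2norm (link_nonneg hμ S x) (link_sum hx) f).trans
    (hg S hS x (lt_of_le_of_ne (marginal_nonneg hμ S x) hx.symm))

/-- A crude bound depending on `k`; like the next two, it enters the fourth moment estimate only
through terms that also carry a power of `ε`. -/
lemma IsGlobal.abs_linkComponent_le (hμ : ∀ x, 0 ≤ μ x) (hδ : 0 ≤ δ) (hg : IsGlobal μ d δ f)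
    (h : (J ∪ T).card ≤ d) (hx : μ x ≠ 0) : |linkComponent μ J T f x| ≤ 2 ^ k * δ := by
  rw [linkComponent, Finset.sum_apply]
  refine (Finset.abs_sum_le_sum_abs _ _).trans (sum_powerset_le hδ fun R hR => ?_)
  rw [Pi.smul_apply, smul_eq_mul, abs_neg_one_pow_smul]
  refine hg.abs_average_le hμ (le_trans (Finset.card_le_card ?_) h) (marginal_pos_self hμ hx _).ne'
  exact Finset.union_subset_union_right (Finset.mem_powerset.1 hR)

lemma IsGlobal.abs_efronStein_le (hμ : ∀ x, 0 ≤ μ x) (hδ : 0 ≤ δ) (hg : IsGlobal μ d δ f)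
    (h : T.card ≤ d) (hx : μ x ≠ 0) : |efronStein μ T f x| ≤ 2 ^ k * δ := by
  rw [← linkComponent_empty]
  exact hg.abs_linkComponent_le hμ hδ (by rwa [Finset.empty_union]) hx

lemma IsGlobal.abs_lowDegree_le (hμ : ∀ x, 0 ≤ μ x) (hδ : 0 ≤ δ) (hg : IsGlobal μ d δ f)
    (hx : μ x ≠ 0) : |lowDegree μ d f x| ≤ 4 ^ k * δ := by
  refine (Finset.abs_sum_le_sum_abs _ _).trans ((sum_finset_fin_le _ (c := 2 ^ k * δ)
    (by positivity) fun S hS => hg.abs_efronStein_le hμ hδ (Finset.mem_filter.1 hS).2 hx).trans ?_)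
  rw [← mul_assoc, ← mul_pow]
  norm_num

/-- Given `x_J`, the components `f^{=S}` and `linkComponent μ J (T \ S) f` are nearly
independent. -/
lemma IsEpsProduct.expect_efronStein_sq_mul_linkComponent_sq_le (hμ : ∀ x, 0 ≤ μ x) (hε : 0 ≤ ε)
    (hp : IsEpsProduct ε μ) (hδ : 0 ≤ δ) (hg : IsGlobal μ d δ f) (hS : S.card ≤ d)
    (hT : T.card ≤ d) (hJ : J ⊆ S ∩ T) :
    expect μ (efronStein μ S f ^ 2 * linkComponent μ J (T \ S) f ^ 2)
      ≤ expect μ (efronStein μ S f ^ 2 * average μ J (linkComponent μ J (T \ S) f ^ 2))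
        + 16 ^ k * k ^ 2 * ε * (δ ^ 2 * l2norm μ f ^ 2) := by
  set u := efronStein μ S f ^ 2 with hu
  set v := linkComponent μ J (T \ S) f ^ 2 with hv
  have hud : DependsOn u (S : Set (Fin k)) := fun y z h => by
    simp only [hu, Pi.pow_apply, dependsOn_efronStein μ S f h]
  have hvd : DependsOn v (J ∪ T \ S : Finset (Fin k)) := fun y z h => by
    simp only [hv, Pi.pow_apply, dependsOn_linkComponent μ J (T \ S) f h]
  -- Since `u` depends on `S` and `v` on `J ∪ T \ S`, the product may be averaged as `A_S A_{J ∪ T \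
  -- S} v`, which is close to `A_J v` because the two sets meet in `J`.
  have e1 : expect μ (u * v) = expect μ (u * average μ J v)
      + expect μ (u * (average μ S (average μ (J ∪ T \ S) v) - average μ J v)) := by
    rw [← expect_add, mul_sub, add_sub_cancel, expect_mul_average hμ hud]
    exact expect_congr fun x hx => by
      rw [Pi.mul_apply, Pi.mul_apply, average_eq_self hμ hvd hx]
  have hn := l2norm_nonneg μ f
  have b1 : l2norm μ u ≤ 2 ^ k * δ * (2 ^ k * l2norm μ f) :=
    (l2norm_sq_le hμ (by positivity) fun x hx => hg.abs_efronStein_le hμ hδ hS hx).trans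
      (mul_le_mul_of_nonneg_left (l2norm_efronStein_le hμ S f) (by positivity))
  have b2 : l2norm μ v ≤ 2 ^ k * δ * (2 ^ k * l2norm μ f) :=
    (l2norm_sq_le hμ (by positivity) fun x hx => hg.abs_linkComponent_le hμ hδ
      ((Finset.card_le_card (by grind)).trans hT) hx).trans
      (mul_le_mul_of_nonneg_left (l2norm_linkComponent_le hμ J (T \ S) f) (by positivity))
  have b3 := hp.average_average_inter hμ hε S (J ∪ T \ S) v
  rw [show S ∩ (J ∪ T \ S) = J by grind] at b3
  rw [e1]
  refine add_le_add_right ((expect_mul_le hμ _ _).trans ((mul_le_mul b1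
    (b3.trans (mul_le_mul_of_nonneg_left b2 (by positivity))) (l2norm_nonneg _ _)
    (by positivity)).trans (le_of_eq ?_))) _
  rw [show (16 : ℝ) = 2 * 2 * 2 * 2 by norm_num, mul_pow, mul_pow, mul_pow]
  ring

/-- Given `T \ S`, the set `T` is determined by `T ∩ S`, so each value is taken at most `2 ^ S.card`
times. -/
lemma sum_sdiff_le (S : Finset (Fin k)) (s : Finset (Finset (Fin k))) {G : Finset (Fin k) → ℝ}
    (hG : ∀ T, 0 ≤ G T) : ∑ T ∈ s, G (T \ S) ≤ 2 ^ S.card * ∑ T, G T := by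
  have h1 : ∑ T ∈ s, G (T \ S)
      = ∑ p ∈ s.image (fun T => (T ∩ S, T \ S)), G p.2 := by
    rw [Finset.sum_image]
    intro P _ Q _ h
    simp only [Prod.mk.injEq] at h
    rw [← Finset.sdiff_union_inter P S, ← Finset.sdiff_union_inter Q S, h.1, h.2]
  rw [h1]
  refine (Finset.sum_le_sum_of_subset_of_nonneg (t := S.powerset ×ˢ Finset.univ) ?_
    fun p _ _ => hG p.2).trans (le_of_eq ?_)
  · intro p hp
    obtain ⟨T, -, rfl⟩ := Finset.mem_image.1 hp
    simp
  · rw [Finset.sum_product]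
    simp only [Finset.sum_const, Finset.card_powerset, nsmul_eq_mul]
    push_cast
    rfl

/-- For fixed `x_J` these are the squared norms of the Efron–Stein components in the link, so
approximate Parseval there and globalness at `x_J` give the bound. -/
lemma IsEpsProduct.sum_average_linkComponent_sq_le (hμ : ∀ x, 0 ≤ μ x) (hε : 0 ≤ ε)
    (hp : IsEpsProduct ε μ) (hg : IsGlobal μ d δ f) (hJ : J.card ≤ d)
    (hx : marginal μ J x ≠ 0) :
    ∑ T, average μ J (linkComponent μ J T f ^ 2) x ≤ (1 + 16 ^ k * k ^ 2 * ε) * δ ^ 2 := by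
  simp only [average_linkComponent_sq hx]
  refine ((hp.link hμ hε hx).sum_expect_efronStein_sq_le (link_nonneg hμ J x) hε f).trans ?_
  have := pow_le_pow_left₀ (l2norm_nonneg _ _)
    (hg J hJ x (lt_of_le_of_ne (marginal_nonneg hμ J x) hx.symm)) 2
  exact mul_le_mul_of_nonneg_left this (by positivity)

/-- The factor `8 ^ d` is a product of three factors `2 ^ d`: Cauchy–Schwarz over `J ⊆ S ∩ T`, the
fibres of `T ↦ T \ S`, and the number of `J ⊆ S`. -/
lemma IsEpsProduct.sum_expect_efronStein_sq_mul_le (hμ : ∀ x, 0 ≤ μ x) (hε : 0 ≤ ε)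
    (hp : IsEpsProduct ε μ) (hδ : 0 ≤ δ) (hg : IsGlobal μ d δ f) (hS : S.card ≤ d) :
    ∑ T : Finset (Fin k) with T.card ≤ d, expect μ (efronStein μ S f ^ 2 * efronStein μ T f ^ 2)
      ≤ 8 ^ d * ((1 + 16 ^ k * k ^ 2 * ε) * δ ^ 2) * expect μ (efronStein μ S f ^ 2)
        + 128 ^ k * k ^ 2 * ε * (δ ^ 2 * l2norm μ f ^ 2) := by
  set c := (1 + 16 ^ k * k ^ 2 * ε) * δ ^ 2 with hc
  set e := 16 ^ k * k ^ 2 * ε * (δ ^ 2 * l2norm μ f ^ 2) with he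
  set q := efronStein μ S f ^ 2 with hq
  have hc0 : 0 ≤ c := by positivity
  have he0 : 0 ≤ e := by positivity
  set G : Finset (Fin k) → Finset (Fin k) → ℝ := fun J T =>
    expect μ (q * average μ J (linkComponent μ J T f ^ 2)) with hG
  have hG0 : ∀ J T, 0 ≤ G J T := fun J T => expect_nonneg hμ fun x _ =>
    mul_nonneg (sq_nonneg _) (expect_sq_nonneg (link_nonneg hμ J x) _)
  have hGs : ∀ J ∈ S.powerset, ∑ T, G J T ≤ c * expect μ q := by
    intro J hJ
    have hJd : J.card ≤ d := (Finset.card_le_card (Finset.mem_powerset.1 hJ)).trans hS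
    rw [hG, ← expect_sum, ← Finset.mul_sum, ← expect_smul]
    refine expect_mono hμ fun x hx => ?_
    rw [Pi.mul_apply, Finset.sum_apply, Pi.smul_apply, smul_eq_mul, mul_comm]
    exact mul_le_mul_of_nonneg_right (hp.sum_average_linkComponent_sq_le hμ hε hg hJd
      (marginal_pos_self hμ hx J).ne') (sq_nonneg _)
  have h1 : ∀ T ∈ Finset.univ.filter (fun T : Finset (Fin k) => T.card ≤ d),
      expect μ (q * efronStein μ T f ^ 2)
        ≤ 2 ^ d * ∑ J ∈ S.powerset, G J (T \ S) + 2 ^ k * (2 ^ k * e) := by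
    intro T hT
    have hTd := (Finset.mem_filter.1 hT).2
    have a1 : expect μ (q * efronStein μ T f ^ 2)
        ≤ 2 ^ (S ∩ T).card * ∑ J ∈ (S ∩ T).powerset,
          expect μ (q * linkComponent μ J (T \ S) f ^ 2) := by
      rw [← expect_sum, ← expect_smul, ← Finset.mul_sum]
      refine expect_mono hμ fun x _ => ?_
      have := efronStein_sq_le μ (Finset.inter_subset_right : S ∩ T ⊆ T) f x
      rw [show T \ (S ∩ T) = T \ S by grind] at this
      simp only [Pi.mul_apply, Pi.smul_apply, Finset.sum_apply, Pi.pow_apply, smul_eq_mul]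
      rw [mul_left_comm]
      exact mul_le_mul_of_nonneg_left this (sq_nonneg _)
    have a2 : ∑ J ∈ (S ∩ T).powerset, expect μ (q * linkComponent μ J (T \ S) f ^ 2)
        ≤ ∑ J ∈ S.powerset, G J (T \ S) + 2 ^ k * e := by
      have : ∑ J ∈ (S ∩ T).powerset, expect μ (q * linkComponent μ J (T \ S) f ^ 2)
          ≤ ∑ J ∈ (S ∩ T).powerset, (G J (T \ S) + e) :=
        Finset.sum_le_sum fun J hJ => hp.expect_efronStein_sq_mul_linkComponent_sq_le hμ hε hδ hg
          hS hTd (Finset.mem_powerset.1 hJ)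
      refine this.trans ?_
      rw [Finset.sum_add_distrib]
      exact add_le_add (Finset.sum_le_sum_of_subset_of_nonneg
        (Finset.powerset_mono.2 Finset.inter_subset_left) fun J _ _ => hG0 _ _)
        (sum_powerset_le he0 fun _ _ => le_rfl)
    have a3 : (2 : ℝ) ^ (S ∩ T).card ≤ 2 ^ d := pow_le_pow_right₀ (by norm_num)
      ((Finset.card_le_card Finset.inter_subset_left).trans hS)
    have a4 : (2 : ℝ) ^ (S ∩ T).card ≤ 2 ^ k := pow_le_pow_right₀ (by norm_num)
      (card_finset_fin_le _)
    refine a1.trans ((mul_le_mul_of_nonneg_left a2 (by positivity)).trans ?_)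
    rw [mul_add]
    exact add_le_add (mul_le_mul_of_nonneg_right a3 (Finset.sum_nonneg fun J _ => hG0 _ _))
      (mul_le_mul_of_nonneg_right a4 (by positivity))
  refine (Finset.sum_le_sum h1).trans ?_
  rw [Finset.sum_add_distrib, ← Finset.mul_sum, Finset.sum_comm]
  have h2d : (2 : ℝ) ^ S.card ≤ 2 ^ d := pow_le_pow_right₀ (by norm_num) hS
  have hq0 : 0 ≤ expect μ q := expect_sq_nonneg hμ _
  have h2 : ∑ J ∈ S.powerset, ∑ T : Finset (Fin k) with T.card ≤ d, G J (T \ S)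
      ≤ 2 ^ d * (2 ^ d * (c * expect μ q)) := by
    refine (Finset.sum_le_card_nsmul _ _ (2 ^ d * (c * expect μ q)) fun J hJ => ?_).trans ?_
    · exact (sum_sdiff_le S _ (hG0 J)).trans (mul_le_mul h2d (hGs J hJ)
        (Finset.sum_nonneg fun T _ => hG0 J T) (by positivity))
    · rw [nsmul_eq_mul, Finset.card_powerset]
      push_cast
      exact mul_le_mul_of_nonneg_right h2d (by positivity)
  have h3 : ∑ _T : Finset (Fin k) with _T.card ≤ d, 2 ^ k * (2 ^ k * e)
      ≤ 2 ^ k * (2 ^ k * (2 ^ k * e)) :=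
    sum_finset_fin_le _ (by positivity) fun _ _ => le_rfl
  refine (add_le_add (mul_le_mul_of_nonneg_left h2 (by positivity)) h3).trans (le_of_eq ?_)
  rw [he, show (8 : ℝ) = 2 * 2 * 2 by norm_num, show (128 : ℝ) = 2 * 2 * 2 * 16 by norm_num]
  simp only [mul_pow]
  ring

lemma IsEpsProduct.sum_sum_expect_efronStein_sq_mul_le (hμ : ∀ x, 0 ≤ μ x) (hε : 0 ≤ ε)
    (hp : IsEpsProduct ε μ) (hδ : 0 ≤ δ) (hg : IsGlobal μ d δ f) :
    ∑ S : Finset (Fin k) with S.card ≤ d, ∑ T : Finset (Fin k) with T.card ≤ d,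
        expect μ (efronStein μ S f ^ 2 * efronStein μ T f ^ 2)
      ≤ (8 ^ d * (1 + 16 ^ k * k ^ 2 * ε) ^ 2 + 256 ^ k * k ^ 2 * ε)
        * (δ ^ 2 * l2norm μ f ^ 2) := by
  refine (Finset.sum_le_sum fun S hS => hp.sum_expect_efronStein_sq_mul_le hμ hε hδ hg
    (Finset.mem_filter.1 hS).2).trans ?_
  rw [Finset.sum_add_distrib, ← Finset.mul_sum]
  have h1 : ∑ S : Finset (Fin k) with S.card ≤ d, expect μ (efronStein μ S f ^ 2)
      ≤ (1 + 16 ^ k * k ^ 2 * ε) * l2norm μ f ^ 2 :=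
    (Finset.sum_le_sum_of_subset_of_nonneg (Finset.subset_univ _)
      fun S _ _ => expect_sq_nonneg hμ _).trans (hp.sum_expect_efronStein_sq_le hμ hε f)
  have h2 : ∑ _S : Finset (Fin k) with _S.card ≤ d,
      128 ^ k * (k : ℝ) ^ 2 * ε * (δ ^ 2 * l2norm μ f ^ 2)
      ≤ 2 ^ k * (128 ^ k * (k : ℝ) ^ 2 * ε * (δ ^ 2 * l2norm μ f ^ 2)) :=
    sum_finset_fin_le _ (by positivity) fun _ _ => le_rfl
  refine (add_le_add (mul_le_mul_of_nonneg_left h1 (by positivity)) h2).trans (le_of_eq ?_)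
  rw [show (256 : ℝ) = 2 * 128 by norm_num, mul_pow 2 128]
  ring

/-- Hypercontractivity for global functions on `ε`-product measures. -/
lemma IsEpsProduct.expect_lowDegree_pow_four_le (hμ : ∀ x, 0 ≤ μ x) (hε : 0 ≤ ε)
    (hp : IsEpsProduct ε μ) (hsmall : 3 * 256 ^ k * (k : ℝ) ^ 3 * ε ≤ 1) (hδ : 0 ≤ δ)
    (hg : IsGlobal μ d δ f) :
    expect μ (lowDegree μ d f ^ 4) ≤ 21 * 128 ^ d * (δ ^ 2 * l2norm μ f ^ 2) := by
  set N := δ ^ 2 * l2norm μ f ^ 2 with hN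
  have hN0 : 0 ≤ N := by positivity
  set p : Finset (Fin k) → (∀ i, V i) → ℝ := fun S =>
    iteratedPart μ S (List.finRange k) (lowDegree μ d f) with hpdef
  set q : Finset (Fin k) → (∀ i, V i) → ℝ := fun S =>
    if S.card ≤ d then efronStein μ S f else 0 with hqdef
  have hpb : ∀ S x, μ x ≠ 0 → |p S x| ≤ 8 ^ k * δ := by
    intro S x hx
    refine (abs_iteratedPart_le hμ S (List.finRange k) (by positivity)
      (fun y hy => hg.abs_lowDegree_le hμ hδ hy) hx).trans (le_of_eq ?_)
    rw [List.length_finRange, ← mul_assoc, ← mul_pow]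
    norm_num
  have hqb : ∀ S x, μ x ≠ 0 → |q S x| ≤ 8 ^ k * δ := by
    intro S x hx
    simp only [hqdef]
    split_ifs with h
    · refine (hg.abs_efronStein_le hμ hδ h hx).trans (mul_le_mul_of_nonneg_right ?_ hδ)
      exact pow_le_pow_left₀ (by norm_num) (by norm_num) k
    · simp only [Pi.zero_apply, abs_zero]
      positivity
  have herr : ∀ S, expect μ ((p S - q S) ^ 2) ≤ (4 ^ k * k ^ 3 * ε) ^ 2 * l2norm μ f ^ 2 := by
    intro S
    rw [← l2norm_sq hμ, ← mul_pow]
    exact pow_le_pow_left₀ (l2norm_nonneg _ _)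
      (hp.l2norm_iteratedPart_lowDegree_sub_le hμ hε S d f) 2
  set e := 6 * (8 ^ k) ^ 2 * (4 ^ k * k ^ 3 * ε) ^ 2 * N with he
  -- Replacing `p` by `q` one factor at a time uses `a² ≤ 2b² + 2(a - b)²`; the other factor is
  -- bounded pointwise.
  have h1 : ∀ S T, expect μ (p S ^ 2 * p T ^ 2) ≤ 4 * expect μ (q S ^ 2 * q T ^ 2) + e := by
    intro S T
    have : expect μ (p S ^ 2 * p T ^ 2) ≤ expect μ ((4 : ℝ) • (q S ^ 2 * q T ^ 2)
        + ((2 * (8 ^ k * δ) ^ 2) • (p S - q S) ^ 2 + (4 * (8 ^ k * δ) ^ 2) • (p T - q T) ^ 2)) := by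
      refine expect_mono hμ fun x hx => ?_
      simp only [Pi.add_apply, Pi.mul_apply, Pi.pow_apply, Pi.smul_apply, Pi.sub_apply,
        smul_eq_mul]
      have b1 : p T x ^ 2 ≤ (8 ^ k * δ) ^ 2 := by
        rw [← sq_abs]; exact pow_le_pow_left₀ (abs_nonneg _) (hpb T x hx) 2
      have b2 : q S x ^ 2 ≤ (8 ^ k * δ) ^ 2 := by
        rw [← sq_abs]; exact pow_le_pow_left₀ (abs_nonneg _) (hqb S x hx) 2
      have c1 : p S x ^ 2 ≤ 2 * q S x ^ 2 + 2 * (p S x - q S x) ^ 2 := by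
        nlinarith [sq_nonneg (p S x - 2 * q S x)]
      have c2 : p T x ^ 2 ≤ 2 * q T x ^ 2 + 2 * (p T x - q T x) ^ 2 := by
        nlinarith [sq_nonneg (p T x - 2 * q T x)]
      have d1 := mul_le_mul_of_nonneg_right c1 (sq_nonneg (p T x))
      have d2 := mul_le_mul_of_nonneg_left c2 (sq_nonneg (q S x))
      have d3 := mul_le_mul_of_nonneg_left b1 (sq_nonneg (p S x - q S x))
      have d4 := mul_le_mul_of_nonneg_right b2 (sq_nonneg (p T x - q T x))
      linarith
    refine this.trans ?_
    rw [expect_add, expect_add, expect_smul, expect_smul, expect_smul]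
    have a1 := mul_le_mul_of_nonneg_left (herr S)
      (by positivity : 0 ≤ 2 * ((8 : ℝ) ^ k * δ) ^ 2)
    have a2 := mul_le_mul_of_nonneg_left (herr T)
      (by positivity : 0 ≤ 4 * ((8 : ℝ) ^ k * δ) ^ 2)
    have a3 : e = 2 * ((8 : ℝ) ^ k * δ) ^ 2 * ((4 ^ k * k ^ 3 * ε) ^ 2 * l2norm μ f ^ 2)
        + 4 * ((8 : ℝ) ^ k * δ) ^ 2 * ((4 ^ k * k ^ 3 * ε) ^ 2 * l2norm μ f ^ 2) := by
      rw [he, hN]; ring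
    linarith
  have h2 := expect_sq_mul_sq_le hμ (List.nodup_finRange k) (lowDegree μ d f) (lowDegree μ d f)
  rw [List.toFinset_finRange, Finset.powerset_univ, ← pow_add] at h2
  have he0 : 0 ≤ e := by positivity
  -- If the main term is nonzero then `S` and `T` have at most `d` elements, so the weight is at
  -- most `4 ^ (2 * d) = 16 ^ d`. The weight `4 ^ k` falls on the error only.
  have h3 : ∀ S T, (4 : ℝ) ^ (S ∪ T).card * expect μ (p S ^ 2 * p T ^ 2)
      ≤ 4 * 16 ^ d * expect μ (q S ^ 2 * q T ^ 2) + 4 ^ k * e := by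
    intro S T
    have hq0 : 0 ≤ expect μ (q S ^ 2 * q T ^ 2) := expect_nonneg hμ fun x _ =>
      mul_nonneg (sq_nonneg _) (sq_nonneg _)
    have a1 : (4 : ℝ) ^ (S ∪ T).card * expect μ (q S ^ 2 * q T ^ 2)
        ≤ 16 ^ d * expect μ (q S ^ 2 * q T ^ 2) := by
      by_cases hST : S.card ≤ d ∧ T.card ≤ d
      · refine mul_le_mul_of_nonneg_right ?_ hq0
        rw [show (16 : ℝ) = 4 ^ 2 by norm_num, ← pow_mul]
        refine pow_le_pow_right₀ (by norm_num) ((Finset.card_union_le _ _).trans ?_)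
        omega
      · have : q S ^ 2 * q T ^ 2 = 0 := by
          rcases not_and_or.1 hST with h | h <;> simp [hqdef, h]
        rw [this]
        simp [expect]
    have a2 : (4 : ℝ) ^ (S ∪ T).card ≤ 4 ^ k :=
      pow_le_pow_right₀ (by norm_num) (card_finset_fin_le _)
    have a3 := mul_le_mul_of_nonneg_left (h1 S T) (by positivity : 0 ≤ (4 : ℝ) ^ (S ∪ T).card)
    have a4 := mul_le_mul_of_nonneg_right a2 he0
    linarith
  have h4 : ∑ S, ∑ T, expect μ (q S ^ 2 * q T ^ 2)
      ≤ (8 ^ d * (1 + 16 ^ k * k ^ 2 * ε) ^ 2 + 256 ^ k * k ^ 2 * ε) * N := by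
    refine le_trans (le_of_eq ?_) (hp.sum_sum_expect_efronStein_sq_mul_le hμ hε hδ hg)
    rw [Finset.sum_filter]
    refine Finset.sum_congr rfl fun S _ => ?_
    rw [Finset.sum_filter]
    split_ifs with hS
    · refine Finset.sum_congr rfl fun T _ => ?_
      split_ifs with hT
      · simp [hqdef, hS, hT]
      · simp [hqdef, hT, expect]
    · refine Finset.sum_eq_zero fun T _ => ?_
      simp [hqdef, hS, expect]
  have h5 : ∑ S, ∑ T, (4 : ℝ) ^ (S ∪ T).card * expect μ (p S ^ 2 * p T ^ 2)
      ≤ 4 * 16 ^ d * ∑ S, ∑ T, expect μ (q S ^ 2 * q T ^ 2)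
        + 2 ^ k * (2 ^ k * (4 ^ k * e)) := by
    refine (Finset.sum_le_sum fun S _ => Finset.sum_le_sum fun T _ => h3 S T).trans
      (le_of_eq ?_)
    simp only [Finset.sum_add_distrib, ← Finset.mul_sum, Finset.sum_const, nsmul_eq_mul,
      card_finset_fin]
    ring
  have hk23 : (k : ℝ) ^ 2 ≤ k ^ 3 := by
    rcases Nat.eq_zero_or_pos k with rfl | hk
    · simp
    · exact pow_le_pow_right₀ (by exact_mod_cast hk) (by norm_num)
  have h6 : 256 ^ k * (k : ℝ) ^ 2 * ε ≤ 1 := by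
    refine le_trans ?_ hsmall
    have : 256 ^ k * (k : ℝ) ^ 2 * ε ≤ 256 ^ k * (k : ℝ) ^ 3 * ε := by gcongr
    have : 0 ≤ 256 ^ k * (k : ℝ) ^ 3 * ε := by positivity
    linarith
  have h7 : 16 ^ k * (k : ℝ) ^ 2 * ε ≤ 1 := by
    refine le_trans ?_ h6
    gcongr
    norm_num
  -- The factor `3` in `hsmall` is used here: `6 / 9 ≤ 1`. With `h10`, the final constant is `4 * 5
  -- + 1 = 21`.
  have h8 : 2 ^ k * (2 ^ k * (4 ^ k * e)) ≤ N := by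
    have e1 : (2 : ℝ) ^ k * (2 ^ k * (4 ^ k * e))
        = 6 * (128 ^ k * k ^ 3 * ε) ^ 2 * N := by
      rw [he, show (128 : ℝ) = 2 * 2 * 4 * 8 by norm_num, show (4 : ℝ) = 2 * 2 by norm_num]
      simp only [mul_pow]
      ring
    rw [e1]
    refine mul_le_of_le_one_left hN0 ?_
    have e2 : 128 ^ k * (k : ℝ) ^ 3 * ε ≤ 256 ^ k * (k : ℝ) ^ 3 * ε := by
      gcongr
      norm_num
    have e3 : 0 ≤ 128 ^ k * (k : ℝ) ^ 3 * ε := by positivity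
    nlinarith
  have h9 : (1 + 16 ^ k * (k : ℝ) ^ 2 * ε) ^ 2 ≤ 4 := by
    have : 0 ≤ 16 ^ k * (k : ℝ) ^ 2 * ε := by positivity
    nlinarith
  have h10 : 8 ^ d * (1 + 16 ^ k * (k : ℝ) ^ 2 * ε) ^ 2 + 256 ^ k * k ^ 2 * ε
      ≤ 5 * 8 ^ d := by
    have : (1 : ℝ) ≤ 8 ^ d := one_le_pow₀ (by norm_num)
    nlinarith
  have h11 : 4 * 16 ^ d * ∑ S, ∑ T, expect μ (q S ^ 2 * q T ^ 2) ≤ 20 * 128 ^ d * N := by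
    refine (mul_le_mul_of_nonneg_left (h4.trans (mul_le_mul_of_nonneg_right h10 hN0))
      (by positivity)).trans (le_of_eq ?_)
    rw [show (128 : ℝ) = 16 * 8 by norm_num, mul_pow]
    ring
  have h12 : N ≤ 128 ^ d * N := le_mul_of_one_le_left hN0 (one_le_pow₀ (by norm_num))
  have := h2.trans h5
  linarith

end Global

/-! ### From the fourth moment to the level inequality. -/

section LevelInequality

variable {k : ℕ} {V : Fin k → Type u} [∀ i, Fintype (V i)]
  {μ : (∀ i, V i) → ℝ} {ε δ : ℝ} {d : ℕ} {f g : (∀ i, V i) → ℝ}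

lemma marginal_empty (hμ : ∑ x, μ x = 1) (x : ∀ i, V i) : marginal μ ∅ x = 1 := by
  rw [marginal_eq, ← hμ]
  exact Finset.sum_congr rfl fun y _ => by simp [cylinder]

lemma IsGlobal.nonneg (hμ : ∑ x, μ x = 1) (hg : IsGlobal μ d δ f) : 0 ≤ δ := by
  obtain ⟨x, -, -⟩ := Finset.exists_ne_zero_of_sum_ne_zero (hμ ▸ one_ne_zero)
  exact (l2norm_nonneg _ _).trans (hg ∅ (by simp) x (by rw [marginal_empty hμ]; exact one_pos))

lemma lowDegree_zero (μ : (∀ i, V i) → ℝ) (f : (∀ i, V i) → ℝ) :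
    lowDegree μ 0 f = average μ ∅ f := by
  ext x
  simp [lowDegree, efronStein, Finset.filter_eq']

omit [∀ i, Fintype (V i)] in
lemma sq_eq_self_of_boolean (hf : ∀ x, μ x ≠ 0 → f x = 0 ∨ f x = 1) :
    ∀ x, μ x ≠ 0 → f x ^ 2 = f x := fun x hx => by
  rcases hf x hx with h | h <;> simp [h]

/-- Cauchy–Schwarz is applied twice, each time after writing a factor `f` as `f²` where needed. -/
lemma expect_mul_pow_four_le (hμ : ∀ x, 0 ≤ μ x) (hf : ∀ x, μ x ≠ 0 → f x = 0 ∨ f x = 1)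
    (g : (∀ i, V i) → ℝ) :
    expect μ (g * f) ^ 4 ≤ expect μ (g ^ 4) * (l2norm μ f ^ 2) ^ 3 := by
  have hsq := sq_eq_self_of_boolean hf
  have hn0 : 0 ≤ l2norm μ f ^ 2 := sq_nonneg _
  have h1 : expect μ (g * f) ^ 2 ≤ expect μ (g ^ 2 * f) * l2norm μ f ^ 2 := by
    have := expect_mul_sq_le hμ (g * f) f
    rwa [← l2norm_sq hμ f,
      expect_congr (f := g * f * f) (g := g * f) fun x hx => by
        simp only [Pi.mul_apply]; rw [mul_assoc, ← sq, hsq x hx],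
      expect_congr (f := (g * f) ^ 2) (g := g ^ 2 * f) fun x hx => by
        simp only [Pi.mul_apply, Pi.pow_apply]; rw [mul_pow, hsq x hx]] at this
  have h2 : expect μ (g ^ 2 * f) ^ 2 ≤ expect μ (g ^ 4) * l2norm μ f ^ 2 := by
    have := expect_mul_sq_le hμ (g ^ 2) f
    rwa [← l2norm_sq hμ f, ← pow_mul] at this
  calc expect μ (g * f) ^ 4 = (expect μ (g * f) ^ 2) ^ 2 := by ring
    _ ≤ (expect μ (g ^ 2 * f) * l2norm μ f ^ 2) ^ 2 := pow_le_pow_left₀ (sq_nonneg _) h1 2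
    _ = expect μ (g ^ 2 * f) ^ 2 * (l2norm μ f ^ 2) ^ 2 := by ring
    _ ≤ expect μ (g ^ 4) * l2norm μ f ^ 2 * (l2norm μ f ^ 2) ^ 2 :=
        mul_le_mul_of_nonneg_right h2 (by positivity)
    _ = _ := by ring

lemma IsEpsProduct.expect_lowDegree_mul_le (hμ : μ ∈ stdSimplex ℝ (∀ i, V i)) (hε : 0 ≤ ε)
    (hp : IsEpsProduct ε μ) (hsmall : 3 * 256 ^ k * (k : ℝ) ^ 3 * ε ≤ 1)
    (hf : ∀ x, μ x ≠ 0 → f x = 0 ∨ f x = 1) (hg : IsGlobal μ d δ f) :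
    expect μ (lowDegree μ d f * f) ≤ (200 * (d : ℝ)) ^ d * √δ * l2norm μ f ^ 2 := by
  have hδ := hg.nonneg hμ.2
  have hn0 : 0 ≤ l2norm μ f ^ 2 := sq_nonneg _
  rcases Nat.eq_zero_or_pos d with rfl | hd
  -- Degree zero is separate because the constant `21` is not absorbed by `(200 * 0) ^ 0 = 1`. Here
  -- `f^{≤0}` is the mean of `f`, at most `min δ 1 ≤ √δ`.
  · rw [pow_zero, one_mul, l2norm_sq hμ.1, ← expect_smul]
    refine expect_mono hμ.1 fun x hx => ?_
    have hfx : 0 ≤ f x := by rcases hf x hx with h | h <;> simp [h]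
    simp only [Pi.mul_apply, Pi.smul_apply, Pi.pow_apply, smul_eq_mul]
    rw [sq_eq_self_of_boolean hf x hx, lowDegree_zero]
    refine mul_le_mul_of_nonneg_right ((le_abs_self _).trans ?_) hfx
    rcases le_total δ 1 with h | h
    · refine (hg.abs_average_le hμ.1 (by simp) (marginal_pos_self hμ.1 hx ∅).ne').trans ?_
      exact Real.le_sqrt_of_sq_le (by nlinarith)
    · refine (EpsProduct.abs_average_le hμ.1 (M := 1) (fun y hy => ?_) hx).trans
        (Real.one_le_sqrt.2 h)
      rcases hf y hy with h | h <;> simp [h]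
  · refine le_of_pow_le_pow_left₀ (n := 4) (by norm_num) (by positivity) ?_
    have h1 := expect_mul_pow_four_le hμ.1 hf (lowDegree μ d f)
    have h2 := mul_le_mul_of_nonneg_right
      (hp.expect_lowDegree_pow_four_le hμ.1 hε hsmall hδ hg) (pow_nonneg hn0 3)
    have h3 : (21 : ℝ) * 128 ^ d ≤ ((200 * (d : ℝ)) ^ d) ^ 4 := by
      have hd1 : (1 : ℝ) ≤ d := by exact_mod_cast hd
      have a1 : (21 : ℝ) ≤ 21 ^ d := le_self_pow₀ (by norm_num) hd.ne'
      have a2 : (21 * 128 : ℝ) ≤ (200 * d) ^ 4 := by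
        have : (200 : ℝ) ^ 4 ≤ (200 * d) ^ 4 :=
          pow_le_pow_left₀ (by norm_num) (by linarith) 4
        linarith
      calc (21 : ℝ) * 128 ^ d ≤ 21 ^ d * 128 ^ d := by gcongr
        _ = (21 * 128) ^ d := by rw [mul_pow]
        _ ≤ ((200 * d) ^ 4) ^ d := pow_le_pow_left₀ (by norm_num) a2 d
        _ = _ := by rw [← pow_mul, ← pow_mul, mul_comm 4 d]
    have h4 : √δ ^ 4 = δ ^ 2 := by
      rw [show 4 = 2 * 2 from rfl, pow_mul, Real.sq_sqrt hδ]
    refine (h1.trans h2).trans ?_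
    rw [mul_pow, mul_pow, h4]
    calc 21 * 128 ^ d * (δ ^ 2 * l2norm μ f ^ 2) * (l2norm μ f ^ 2) ^ 3
        = 21 * 128 ^ d * (δ ^ 2 * (l2norm μ f ^ 2) ^ 4) := by ring
      _ ≤ ((200 * (d : ℝ)) ^ d) ^ 4 * (δ ^ 2 * (l2norm μ f ^ 2) ^ 4) :=
          mul_le_mul_of_nonneg_right h3 (by positivity)
      _ = _ := by ring

/-- The constant of the level inequality. -/
def levelConst (k : ℕ) : ℝ := 16 ^ k * (3 * 256 ^ k * (k : ℝ) ^ 3 + 1)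

lemma levelConst_pos (k : ℕ) : 0 < levelConst k := by
  unfold levelConst
  positivity

/-- The level inequality for global Boolean functions on `ε`-product measures. -/
theorem IsEpsProduct.level_inequality (hμ : μ ∈ stdSimplex ℝ (∀ i, V i)) (hε : 0 ≤ ε)
    (hp : IsEpsProduct ε μ) (hf : ∀ x, μ x ≠ 0 → f x = 0 ∨ f x = 1) (hg : IsGlobal μ d δ f) :
    l2norm μ (lowDegree μ d f) ^ 2
      ≤ (levelConst k * √ε + (200 * (d : ℝ)) ^ d * √δ) * l2norm μ f ^ 2 := by
  set K : ℝ := 3 * 256 ^ k * (k : ℝ) ^ 3 + 1 with hK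
  have hK1 : 1 ≤ K := by
    have : 0 ≤ 3 * 256 ^ k * (k : ℝ) ^ 3 := by positivity
    linarith
  have hn0 : 0 ≤ l2norm μ f ^ 2 := sq_nonneg _
  rw [levelConst, ← hK]
  -- The fourth moment bound needs small `ε`. If `K * ε > 1`, then `K * √ε ≥ 1` and the crude bound
  -- `‖f^{≤d}‖ ≤ 4^k ‖f‖` is enough.
  rcases le_or_gt (K * ε) 1 with h | h
  · have hsmall : 3 * 256 ^ k * (k : ℝ) ^ 3 * ε ≤ 1 := by
      rw [hK] at h
      linarith
    have hε1 : ε ≤ √ε := by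
      have : ε ≤ 1 := by nlinarith
      exact Real.le_sqrt_of_sq_le (by nlinarith)
    refine (hp.l2norm_lowDegree_sq_le hμ.1 hε d f).trans ?_
    have h1 := hp.expect_lowDegree_mul_le hμ hε hsmall hf hg
    have h2 : 16 ^ k * (k : ℝ) ^ 2 * ε ≤ 16 ^ k * K * √ε := by
      have : (k : ℝ) ^ 2 ≤ K := by
        have a1 : (k : ℝ) ^ 2 ≤ k ^ 3 := by
          rcases Nat.eq_zero_or_pos k with rfl | hk
          · simp
          · exact pow_le_pow_right₀ (by exact_mod_cast hk) (by norm_num)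
        have a2 : (1 : ℝ) ≤ 256 ^ k := one_le_pow₀ (by norm_num)
        have a3 : (0 : ℝ) ≤ (k : ℝ) ^ 3 := by positivity
        rw [hK]
        nlinarith
      gcongr
    have := mul_le_mul_of_nonneg_right h2 hn0
    linarith
  · have h1 : (1 : ℝ) ≤ K * √ε := by
      have : 1 ≤ √(K * ε) := Real.one_le_sqrt.2 h.le
      rw [Real.sqrt_mul (by linarith)] at this
      have h2 : √K ≤ K := Real.sqrt_le_iff.2 ⟨by linarith, by nlinarith⟩
      have := mul_le_mul_of_nonneg_right h2 (Real.sqrt_nonneg ε)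
      linarith
    have h2 := pow_le_pow_left₀ (l2norm_nonneg _ _) (l2norm_lowDegree_le hμ.1 d f) 2
    have h3 : ((4 : ℝ) ^ k * l2norm μ f) ^ 2 = 16 ^ k * l2norm μ f ^ 2 := by
      rw [mul_pow, ← pow_mul, mul_comm k, pow_mul]
      norm_num
    have h4 : (16 : ℝ) ^ k ≤ 16 ^ k * K * √ε := by
      rw [mul_assoc]
      exact le_mul_of_one_le_right (by positivity) h1
    have h5 := mul_le_mul_of_nonneg_right h4 hn0
    have h6 : 0 ≤ (200 * (d : ℝ)) ^ d * √δ * l2norm μ f ^ 2 := by positivity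
    linarith

end LevelInequality

/-! ### From eigenvalues of a reversible walk to pseudorandomness. -/

section Spectral

lemma norm_apply_le_of_eigenvalues {E : Type*} [NormedAddCommGroup E] [InnerProductSpace ℝ E]
    [FiniteDimensional ℝ E] {T : E →ₗ[ℝ] E} (hT : T.IsSymmetric) {ε : ℝ} (hε : 0 ≤ ε)
    (H : ∀ (l : ℝ) (u : E), u ≠ 0 → T u = l • u → |l| ≤ ε) (u : E) : ‖T u‖ ≤ ε * ‖u‖ := by
  refine (sq_le_sq₀ (norm_nonneg _) (by positivity)).1 ?_
  set b := hT.eigenvectorBasis rfl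
  rw [mul_pow, ← b.sum_sq_norm_inner_right (T u), ← b.sum_sq_norm_inner_right u, Finset.mul_sum]
  refine Finset.sum_le_sum fun i _ => ?_
  have hb : T (b i) = hT.eigenvalues rfl i • b i := hT.apply_eigenvectorBasis rfl i
  rw [← hT (b i) u, hb, real_inner_smul_left, norm_mul, mul_pow]
  refine mul_le_mul_of_nonneg_right (pow_le_pow_left₀ (norm_nonneg _) ?_ 2) (sq_nonneg _)
  exact H _ (b i) (b.toBasis.ne_zero i |> fun h => by simpa using h) hb

variable {V : Type v} [Fintype V] [DecidableEq V] {W : V → V → ℝ} {ε : ℝ}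

omit [DecidableEq V] in
lemma weight_eq_zero_of_degree (hW : ∀ a b, 0 ≤ W a b) {a : V} (ha : ∑ b, W a b = 0) (b : V) :
    W a b = 0 :=
  (Finset.sum_eq_zero_iff_of_nonneg fun b _ => hW a b).1 ha b (Finset.mem_univ b)

/-- A bound on the nontrivial eigenvalues of a reversible random walk bounds the associated
bilinear form on functions of mean zero. -/
lemma abs_sum_weight_le (hW : ∀ a b, 0 ≤ W a b) (hsymm : ∀ a b, W a b = W b a) (hε : 0 ≤ ε)
    (H : ∀ (l : ℝ) (φ : V → ℝ), φ ≠ 0 →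
      Matrix.mulVec (fun a b => W a b / ∑ c, W a c) φ = l • φ →
        ∑ a, (∑ b, W a b) * φ a = 0 → |l| ≤ ε)
    {φ ψ : V → ℝ} (hφ : ∑ a, (∑ b, W a b) * φ a = 0) :
    |∑ a, ∑ b, W a b * (φ a * ψ b)|
      ≤ ε * (√(∑ a, (∑ b, W a b) * φ a ^ 2) * √(∑ a, (∑ b, W a b) * ψ a ^ 2)) := by
  set D : V → ℝ := fun a => ∑ b, W a b with hD
  have hD0 : ∀ a, 0 ≤ D a := fun a => Finset.sum_nonneg fun b _ => hW a b
  have hWl : ∀ a b, D a = 0 → W a b = 0 := fun a b h => weight_eq_zero_of_degree hW h b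
  have hWr : ∀ a b, D b = 0 → W a b = 0 := fun a b h => by rw [hsymm, hWl b a h]
  have hsq : ∀ a, √(D a) * √(D a) = D a := fun a => Real.mul_self_sqrt (hD0 a)
  have hs0 : ∀ a, D a ≠ 0 → √(D a) ≠ 0 := fun a h => (Real.sqrt_ne_zero (hD0 a)).2 h
  -- Conjugating the walk by `√D` makes it symmetric, with the constants going to `√D`. Division by
  -- zero gives zero rows and columns at vertices of degree zero.
  set M : Matrix V V ℝ := fun a b => W a b / (√(D a) * √(D b)) with hM
  have hMh : M.IsHermitian := Matrix.IsHermitian.ext fun a b => by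
    change W b a / (√(D b) * √(D a)) = W a b / (√(D a) * √(D b))
    rw [hsymm b a, mul_comm]
  set T := Matrix.toEuclideanLin M with hT
  have hTs : T.IsSymmetric := Matrix.isSymmetric_toEuclideanLin_iff.2 hMh
  have hTa : ∀ (u : EuclideanSpace ℝ V) a, T u a = ∑ b, M a b * u b := fun u a => rfl
  have hMs : ∀ a b, M a b * √(D b) = W a b / √(D a) := by
    intro a b
    by_cases hb : D b = 0
    · simp [hM, hWr a b hb]
    · have := hs0 b hb
      simp only [hM]
      rw [div_mul_eq_mul_div, mul_div_mul_right _ _ this]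
  have hT0 : T (toEuclidean D 1) = toEuclidean D 1 := by
    ext a
    rw [hTa]
    simp only [toEuclidean, Pi.one_apply, mul_one, hMs, ← Finset.sum_div]
    change D a / √(D a) = _
    exact Real.div_sqrt
  set U := (ℝ ∙ toEuclidean D 1)ᗮ with hU
  have hUmem : ∀ u : EuclideanSpace ℝ V, u ∈ U ↔ ∑ a, √(D a) * u a = 0 := by
    intro u
    rw [hU, Submodule.mem_orthogonal_singleton_iff_inner_right]
    simp [toEuclidean, PiLp.inner_apply, mul_comm]
  have hinv : ∀ u ∈ U, T u ∈ U := by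
    intro u hu
    rw [hU, Submodule.mem_orthogonal_singleton_iff_inner_right] at hu ⊢
    rw [← hTs, hT0, hu]
  have hbound := norm_apply_le_of_eigenvalues (hTs.restrict_invariant hinv) hε (by
    rintro l ⟨u, hu⟩ hu0 hl
    have hu0' : u ≠ 0 := fun h => hu0 (by simp [h])
    have hl' : ∀ a, ∑ b, M a b * u b = l * u a := by
      intro a
      have := congrArg (fun w : U => (w : EuclideanSpace ℝ V) a) hl
      simpa [hTa] using this
    -- An eigenvector living only on vertices of degree zero does not come from one of the walk, but
    -- `M` kills it, so its eigenvalue is `0`.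
    by_cases hz : ∃ a, D a ≠ 0 ∧ u a ≠ 0
    · obtain ⟨a₀, ha₀, hua₀⟩ := hz
      refine H l (fun a => u a / √(D a)) ?_ ?_ ?_
      · intro h
        exact div_ne_zero hua₀ (hs0 a₀ ha₀) (congrFun h a₀)
      · ext a
        simp only [Matrix.mulVec, dotProduct, Pi.smul_apply, smul_eq_mul]
        rw [← mul_div_assoc, ← hl' a, Finset.sum_div]
        refine Finset.sum_congr rfl fun b _ => ?_
        simp only [hM]
        change W a b / D a * _ = _
        rw [div_mul_div_comm, div_mul_eq_mul_div, div_div]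
        congr 1
        linear_combination -√(D b) * hsq a
      · rw [← (hUmem u).1 hu]
        refine Finset.sum_congr rfl fun a _ => ?_
        change D a * (u a / √(D a)) = _
        rw [← mul_div_assoc, mul_div_right_comm, Real.div_sqrt]
    · push Not at hz
      obtain ⟨a, ha⟩ : ∃ a, u a ≠ 0 := by
        by_contra! h
        exact hu0' (by ext a; simpa using h a)
      have h0 : l * u a = 0 := by
        rw [← hl' a]
        refine Finset.sum_eq_zero fun b _ => ?_
        by_cases hb : D b = 0
        · simp [hM, hWr a b hb]
        · rw [hz b hb, mul_zero]
      rw [(mul_eq_zero.1 h0).resolve_right ha, abs_zero]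
      exact hε)
  have hφU : toEuclidean D φ ∈ U := by
    rw [hUmem, ← hφ]
    refine Finset.sum_congr rfl fun a _ => ?_
    change √(D a) * (√(D a) * φ a) = D a * φ a
    rw [← mul_assoc, hsq]
  have h1 : ‖T (toEuclidean D φ)‖ ≤ ε * ‖toEuclidean D φ‖ := hbound ⟨_, hφU⟩
  have h2 : ∑ a, ∑ b, W a b * (φ a * ψ b)
      = inner ℝ (T (toEuclidean D φ)) (toEuclidean D ψ) := by
    rw [PiLp.inner_apply, Finset.sum_comm]
    refine Finset.sum_congr rfl fun a _ => ?_
    simp only [RCLike.inner_apply, conj_trivial, hTa]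
    simp only [toEuclidean, ← mul_assoc, hMs, Finset.mul_sum]
    refine Finset.sum_congr rfl fun b _ => ?_
    by_cases ha : D a = 0
    · simp [hWl a b ha, hWr b a ha]
    · have := hs0 a ha
      rw [hsymm b a]
      field_simp
  rw [h2]
  refine (abs_real_inner_le_norm _ _).trans ((mul_le_mul_of_nonneg_right h1
    (norm_nonneg _)).trans (le_of_eq ?_))
  rw [norm_toEuclidean hD0, norm_toEuclidean hD0, mul_assoc]
  rfl

/-- By symmetry of `W` both marginals are proportional to the degrees, so subtracting means turns
the covariance into the bilinear form of `W` on centred functions. -/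
lemma isPseudorandom_of_weight (hW : ∀ a b, 0 ≤ W a b) (hsymm : ∀ a b, W a b = W b a) (hε : 0 ≤ ε)
    (H : ∀ (l : ℝ) (φ : V → ℝ), φ ≠ 0 →
      Matrix.mulVec (fun a b => W a b / ∑ c, W a c) φ = l • φ →
        ∑ a, (∑ b, W a b) * φ a = 0 → |l| ≤ ε)
    {ν : V × V → ℝ} (hν : ∑ p, ν p = 1) {c : ℝ} (hc : 0 ≤ c)
    (hνW : ∀ a b, ν (a, b) = c * W a b) : IsPseudorandom ε ν := by
  intro f₁ f₂
  have hfst : ∀ g : V → ℝ, expect ν (fun p => g p.1) = c * ∑ a, (∑ b, W a b) * g a := by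
    intro g
    simp only [expect, Fintype.sum_prod_type, hνW, Finset.mul_sum, Finset.sum_mul, mul_assoc]
  have hsnd : ∀ g : V → ℝ, expect ν (fun p => g p.2) = c * ∑ a, (∑ b, W a b) * g a := by
    intro g
    simp only [expect, Fintype.sum_prod_type, hνW, Finset.mul_sum, Finset.sum_mul, mul_assoc]
    rw [Finset.sum_comm]
    simp only [hsymm]
  set e₁ := expect ν (fun p => f₁ p.1) with he₁
  set e₂ := expect ν (fun p => f₂ p.2) with he₂
  have hc0 : c ≠ 0 := by
    rintro rfl
    simp [hνW] at hν
  have hφ : ∑ a, (∑ b, W a b) * (f₁ a - e₁) = 0 := by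
    have h := hfst fun a => f₁ a - e₁
    have h' : expect ν (fun p => f₁ p.1 - e₁) = 0 := by
      change expect ν ((fun p => f₁ p.1) - fun _ => e₁) = 0
      rw [expect_sub, expect_const hν, sub_self]
    rw [h'] at h
    exact (mul_eq_zero.1 h.symm).resolve_left hc0
  have key := abs_sum_weight_le hW hsymm hε H (φ := fun a => f₁ a - e₁)
    (ψ := fun a => f₂ a - e₂) hφ
  have hcov : expect ν (fun p => f₁ p.1 * f₂ p.2) - e₁ * e₂
      = c * ∑ a, ∑ b, W a b * ((f₁ a - e₁) * (f₂ b - e₂)) := by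
    have h1 : (fun p : V × V => f₁ p.1 * f₂ p.2) = (fun p => (f₁ p.1 - e₁) * (f₂ p.2 - e₂))
        + e₂ • (fun p => f₁ p.1) + e₁ • (fun p => f₂ p.2) - fun _ => e₁ * e₂ := by
      ext p
      simp only [Pi.add_apply, Pi.sub_apply, Pi.smul_apply, smul_eq_mul]
      ring
    rw [h1, expect_sub, expect_add, expect_add, expect_smul, expect_smul, expect_const hν, ← he₁,
      ← he₂, expect, Fintype.sum_prod_type]
    simp only [hνW, Finset.mul_sum, mul_assoc]
    ring
  have hv₁ : variance ν (fun p => f₁ p.1) = c * ∑ a, (∑ b, W a b) * (f₁ a - e₁) ^ 2 :=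
    hfst fun a => (f₁ a - e₁) ^ 2
  have hv₂ : variance ν (fun p => f₂ p.2) = c * ∑ a, (∑ b, W a b) * (f₂ a - e₂) ^ 2 :=
    hsnd fun a => (f₂ a - e₂) ^ 2
  have hn : 0 ≤ ∑ a, (∑ b, W a b) * (f₁ a - e₁) ^ 2 := Finset.sum_nonneg fun a _ =>
    mul_nonneg (Finset.sum_nonneg fun b _ => hW a b) (sq_nonneg _)
  rw [hcov, hv₁, hv₂, abs_mul, abs_of_nonneg hc]
  refine (mul_le_mul_of_nonneg_left key hc).trans (le_of_eq ?_)
  rw [mul_mul_mul_comm, Real.sqrt_mul (mul_nonneg hc hc), Real.sqrt_mul_self hc,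
    Real.sqrt_mul hn]
  ring

end Spectral

/-! ### The face measure of an ε-HDX. -/

section HDX

variable {V : Type v} [Fintype V] [DecidableEq V] {X : PreAbstractSimplicialComplex V} {k : ℕ}
  {ε : ℝ}

lemma mem_orderedFaces {x : Fin k → V} : x ∈ orderedFaces X k ↔
    Function.Injective x ∧ Finset.univ.image x ∈ X.faces := by
  simp only [orderedFaces, Finset.mem_filter, Finset.mem_univ, true_and]

lemma IsPure.orderedFaces_nonempty (hX : IsPure X k) : (orderedFaces X k).Nonempty := by
  obtain ⟨⟨s, hs⟩, h⟩ := hX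
  obtain ⟨t, ht, -, hcard⟩ := h s hs
  obtain ⟨g, -⟩ := Finset.exists_equiv_extend_of_card_eq (α := Fin k) (t := t) (by simp [hcard])
    (s := ∅) (f := fun i => (t.equivFin.symm (Fin.cast hcard.symm i) : V)) (by simp) (by simp)
  refine ⟨fun i => g i, mem_orderedFaces.2 ⟨Subtype.val_injective.comp g.injective, ?_⟩⟩
  convert ht
  ext a
  simp only [Finset.mem_image, Finset.mem_univ, true_and]
  exact ⟨fun ⟨i, hi⟩ => hi ▸ (g i).2, fun ha => ⟨g.symm ⟨a, ha⟩, by simp⟩⟩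

lemma IsPure.faceMeasure_mem_stdSimplex (hX : IsPure X k) :
    faceMeasure X k ∈ stdSimplex ℝ (Fin k → V) := by
  have h : ((orderedFaces X k).card : ℝ) ≠ 0 := by
    exact_mod_cast hX.orderedFaces_nonempty.card_pos.ne'
  refine ⟨fun x => ?_, ?_⟩
  · unfold faceMeasure
    split_ifs <;> positivity
  · simp only [faceMeasure, Finset.sum_ite_mem, Finset.univ_inter, Finset.sum_const, nsmul_eq_mul]
    field_simp

lemma mem_orderedFaces_of_faceMeasure_ne_zero {x : Fin k → V} (h : faceMeasure X k x ≠ 0) :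
    x ∈ orderedFaces X k := by
  by_contra h'
  exact h (if_neg h')

/-- The number of orderings of a `k`-element set `t` that extend a given injective assignment on
`P` does not depend on `t` or on the assignment. -/
lemma card_orderings_extending {t : Finset V} (ht : t.card = k) {P : Finset (Fin k)}
    {z : Fin k → V} (hzt : P.image z ⊆ t) (hz : Set.InjOn z P) :
    (Finset.univ.filter fun y : Fin k → V =>
        Function.Injective y ∧ Finset.univ.image y = t ∧ ∀ m ∈ P, y m = z m).card
      = (Finset.univ.filter fun σ : Equiv.Perm (Fin k) => ∀ m ∈ P, σ m = m).card := by
  classical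
  obtain ⟨g, hg⟩ := Finset.exists_equiv_extend_of_card_eq (by simp [ht]) hzt hz
  symm
  refine Finset.card_bij (fun σ _ m => (g (σ m) : V)) ?_ ?_ ?_
  · intro σ hσ
    simp only [Finset.mem_filter, Finset.mem_univ, true_and] at hσ ⊢
    refine ⟨Subtype.val_injective.comp (g.injective.comp σ.injective), ?_, fun m hm => ?_⟩
    · ext a
      simp only [Finset.mem_image, Finset.mem_univ, true_and]
      exact ⟨fun ⟨i, hi⟩ => hi ▸ (g _).2, fun ha => ⟨σ.symm (g.symm ⟨a, ha⟩), by simp⟩⟩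
    · rw [hσ m hm, hg m hm]
  · intro σ _ τ _ h
    ext m
    have := congrFun h m
    rw [g.injective (Subtype.val_injective this)]
  · intro y hy
    simp only [Finset.mem_filter, Finset.mem_univ, true_and] at hy
    obtain ⟨hyi, hyt, hyz⟩ := hy
    have hmem : ∀ m, y m ∈ t := fun m => hyt ▸ Finset.mem_image_of_mem y (Finset.mem_univ m)
    set τ : Fin k → Fin k := fun m => g.symm ⟨y m, hmem m⟩ with hτ
    have hτi : Function.Injective τ := fun m n h => by
      have := g.symm.injective h
      exact hyi (congrArg Subtype.val this)
    refine ⟨Equiv.ofBijective τ hτi.bijective_of_finite, ?_, ?_⟩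
    · simp only [Finset.mem_filter, Finset.mem_univ, true_and, Equiv.ofBijective_apply]
      intro m hm
      simp only [hτ]
      rw [Equiv.symm_apply_eq]
      exact Subtype.ext ((hyz m hm).trans (hg m hm).symm)
    · ext m
      simp [hτ]

/-- The orderings are sorted by their underlying top face: every top face containing `x_S`, `a` and
`b` contributes the same number. If `a`, `b` repeat each other or a value of `x_S`, injectivity
leaves no ordering. -/
lemma card_orderedFaces_extending {S : Finset (Fin k)} {x : Fin k → V} (hx : Set.InjOn x S)
    {i j : Fin k} (hi : i ∉ S) (hj : j ∉ S) (hij : i ≠ j) (a b : V) :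
    (((orderedFaces X k).filter fun y => (∀ m ∈ S, y m = x m) ∧ y i = a ∧ y j = b).card : ℝ)
      = (Finset.univ.filter fun σ : Equiv.Perm (Fin k) =>
          ∀ m ∈ insert i (insert j S), σ m = m).card * linkWeight X k (S.image x) a b := by
  classical
  unfold linkWeight
  split_ifs with h
  · obtain ⟨ha, hb, hab⟩ := h
    set z := Function.update (Function.update x i a) j b with hz
    have hzj : z j = b := by simp [hz]
    have hzi : z i = a := by simp [hz, hij]
    have hzS : ∀ m ∈ S, z m = x m := fun m hm => by
      rw [hz, Function.update_of_ne (by rintro rfl; exact hj hm),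
        Function.update_of_ne (by rintro rfl; exact hi hm)]
    have hzimg : (insert i (insert j S)).image z = S.image x ∪ {a, b} := by
      rw [Finset.image_insert, Finset.image_insert, hzi, hzj, Finset.image_congr hzS]
      ext w
      simp only [Finset.mem_insert, Finset.mem_union, Finset.mem_singleton]
      tauto
    have hzinj : Set.InjOn z (insert i (insert j S) : Finset (Fin k)) := by
      rw [← Finset.card_image_iff, hzimg, Finset.card_union_of_disjoint, Finset.card_pair hab,
        Finset.card_image_of_injOn hx, Finset.card_insert_of_notMem (by simp [hij, hi]),
        Finset.card_insert_of_notMem hj]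
      simp [ha, hb]
    have hagree : ∀ y : Fin k → V, ((∀ m ∈ S, y m = x m) ∧ y i = a ∧ y j = b)
        ↔ ∀ m ∈ insert i (insert j S), y m = z m := by
      intro y
      rw [Finset.forall_mem_insert, Finset.forall_mem_insert, hzi, hzj]
      constructor
      · exact fun h => ⟨h.2.1, h.2.2, fun m hm => (h.1 m hm).trans (hzS m hm).symm⟩
      · exact fun h => ⟨fun m hm => (h.2.2 m hm).trans (hzS m hm), h.1, h.2.1⟩
    rw [Finset.card_eq_sum_card_fiberwise (f := fun y => Finset.univ.image y)
      (t := Finset.univ.filter fun t : Finset V =>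
        t ∈ X.faces ∧ t.card = k ∧ S.image x ∪ {a, b} ⊆ t)]
    · rw [Finset.sum_const_nat (m := (Finset.univ.filter fun σ : Equiv.Perm (Fin k) =>
          ∀ m ∈ insert i (insert j S), σ m = m).card)]
      · rw [degree, mul_comm]
        push_cast
        congr
      · intro t ht
        simp only [Finset.mem_filter, Finset.mem_univ, true_and] at ht
        rw [← card_orderings_extending ht.2.1 (hzimg ▸ ht.2.2) hzinj]
        congr 1
        ext y
        simp only [Finset.mem_filter, Finset.mem_univ, true_and, mem_orderedFaces, hagree]
        constructor
        · exact fun h => ⟨h.1.1.1, h.2, h.1.2⟩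
        · exact fun h => ⟨⟨⟨h.1, h.2.1 ▸ ht.1⟩, h.2.2⟩, h.2.1⟩
    · intro y hy
      simp only [Finset.coe_filter, Finset.mem_univ, true_and, Set.mem_ofPred_eq,
        mem_orderedFaces, hagree] at hy ⊢
      refine ⟨hy.1.2, ?_, ?_⟩
      · rw [Finset.card_image_of_injective _ hy.1.1, Finset.card_univ, Fintype.card_fin]
      · rw [← hzimg]
        intro w hw
        obtain ⟨m, hm, rfl⟩ := Finset.mem_image.1 hw
        rw [← hy.2 m hm]
        exact Finset.mem_image_of_mem y (Finset.mem_univ m)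
  · rw [mul_zero, Nat.cast_eq_zero, Finset.card_eq_zero, Finset.filter_eq_empty_iff]
    rintro y hy ⟨hS, rfl, rfl⟩
    have hyi := (mem_orderedFaces.1 hy).1
    refine h ⟨fun hm => ?_, fun hm => ?_, fun h => hij (hyi h)⟩
    · obtain ⟨m, hm, hmi⟩ := Finset.mem_image.1 hm
      rw [← hS m hm] at hmi
      exact hi (hyi hmi ▸ hm)
    · obtain ⟨m, hm, hmj⟩ := Finset.mem_image.1 hm
      rw [← hS m hm] at hmj
      exact hj (hyi hmj ▸ hm)

lemma linkWeight_comm (X : PreAbstractSimplicialComplex V) (k : ℕ) (s : Finset V) (a b : V) :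
    linkWeight X k s a b = linkWeight X k s b a := by
  unfold linkWeight
  rw [Finset.pair_comm]
  congr 1
  exact propext ⟨fun h => ⟨h.2.1, h.1, h.2.2.symm⟩, fun h => ⟨h.2.1, h.1, h.2.2.symm⟩⟩

lemma linkWeight_nonneg (X : PreAbstractSimplicialComplex V) (k : ℕ) (s : Finset V) (a b : V) :
    0 ≤ linkWeight X k s a b := by
  unfold linkWeight
  split_ifs <;> positivity

/-- The measure of an `ε`-HDX is an `ε`-product measure. -/
theorem IsHDX.isEpsProduct (hε : 0 ≤ ε) (hX : IsHDX ε X k) : IsEpsProduct ε (faceMeasure X k) := by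
  classical
  have hμ := hX.1.faceMeasure_mem_stdSimplex
  intro S hS x hx i j hi hj hij
  obtain ⟨y, hy, hyx⟩ := exists_of_marginal_ne_zero hx.ne'
  obtain ⟨hyi, hyf⟩ := mem_orderedFaces.1 (mem_orderedFaces_of_faceMeasure_ne_zero hy)
  have hxinj : Set.InjOn x S := fun m hm n hn h => by
    rw [← hyx m hm, ← hyx n hn] at h
    exact hyi h
  have himg : S.image x = S.image y := Finset.image_congr fun m hm => (hyx m hm).symm
  have hface : S.image x = ∅ ∨ S.image x ∈ X.faces := by
    rcases Finset.eq_empty_or_nonempty (S.image x) with h | h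
    · exact Or.inl h
    · refine Or.inr ((X.isRelLowerSet_faces hyf).2 ?_ h)
      rw [himg]
      exact Finset.image_subset_image (Finset.subset_univ S)
  have hcard : (S.image x).card + 2 ≤ k := (Nat.add_le_add_right Finset.card_image_le 2).trans hS
  set N := (Finset.univ.filter fun σ : Equiv.Perm (Fin k) =>
    ∀ m ∈ insert i (insert j S), σ m = m).card
  -- The constant `c` is the number of orderings per top face, divided by the normalisations of the
  -- face measure and of its link.
  refine isPseudorandom_of_weight (linkWeight_nonneg X k (S.image x))
    (linkWeight_comm X k (S.image x)) hε (hX.2 _ hface hcard) ?_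
    (c := N / ((orderedFaces X k).card * marginal (faceMeasure X k) S x)) (by positivity) ?_
  · have h := expect_skeleton (link (faceMeasure X k) S x) i j fun _ => 1
    simpa [expect, link_sum hx.ne'] using h
  · intro a b
    rw [div_mul_eq_mul_div, ← card_orderedFaces_extending hxinj hi hj hij, skeleton,
      Finset.card_filter, Nat.cast_sum, Finset.sum_div, ← Finset.sum_subset
        (Finset.subset_univ (orderedFaces X k))]
    · refine Finset.sum_congr rfl fun y hy => ?_
      simp only [link, faceMeasure, if_pos hy]
      by_cases h1 : ∀ m ∈ S, y m = x m <;> by_cases h2 : y i = a ∧ y j = b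
      · simp only [h2, and_self, and_true, if_pos h1]
        simp [div_eq_mul_inv, mul_comm]
      all_goals simp [h1, h2]
    · intro y _ hy
      simp [link, faceMeasure, hy]

end HDX

end EpsProduct

end

/-! ### The main theorem. -/

theorem mainTheorem3 :
    (∀ k : ℕ, ∃ C : ℝ, 0 < C ∧
      (∀ (V : Fin k → Type u) [∀ i, Fintype (V i)] (μ : (∀ i, V i) → ℝ) (ε δ : ℝ) (d : ℕ)
          (f : (∀ i, V i) → ℝ),
        μ ∈ stdSimplex ℝ (∀ i, V i) → 0 ≤ ε → IsEpsProduct ε μ →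
        (∀ x, 0 < μ x → f x = 0 ∨ f x = 1) → IsGlobal μ d δ f →
        l2norm μ (lowDegree μ d f) ^ 2
          ≤ (C * √ε + (200 * (d : ℝ)) ^ d * √δ) * l2norm μ f ^ 2) ∧
      (∀ (V : Type v) [Fintype V] [DecidableEq V] (X : PreAbstractSimplicialComplex V)
          (ε δ : ℝ) (d : ℕ) (f : Finset V → ℝ),
        0 ≤ ε → IsHDX ε X k →
        (∀ σ ∈ X.faces, σ.card = k → f σ = 0 ∨ f σ = 1) →
        IsGlobal (faceMeasure X k) d δ (onTuples k f) →
        l2norm (faceMeasure X k) (lowDegree (faceMeasure X k) d (onTuples k f)) ^ 2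
          ≤ (C * √ε + (200 * (d : ℝ)) ^ d * √δ)
            * l2norm (faceMeasure X k) (onTuples k f) ^ 2)) ∧
    (∀ (ζ : ℝ) (d : ℕ), 0 < ζ → ∃ δ₀ : ℝ, 0 < δ₀ ∧ ∀ k : ℕ, ∃ ε₀ : ℝ, 0 < ε₀ ∧
      (∀ (V : Fin k → Type u) [∀ i, Fintype (V i)] (μ : (∀ i, V i) → ℝ) (ε δ : ℝ)
          (f : (∀ i, V i) → ℝ),
        μ ∈ stdSimplex ℝ (∀ i, V i) → 0 ≤ ε → ε ≤ ε₀ → δ ≤ δ₀ → IsEpsProduct ε μ →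
        (∀ x, 0 < μ x → f x = 0 ∨ f x = 1) → IsGlobal μ d δ f →
        l2norm μ (lowDegree μ d f) ^ 2 ≤ ζ * l2norm μ f ^ 2) ∧
      (∀ (V : Type v) [Fintype V] [DecidableEq V] (X : PreAbstractSimplicialComplex V)
          (ε δ : ℝ) (f : Finset V → ℝ),
        0 ≤ ε → ε ≤ ε₀ → δ ≤ δ₀ → IsHDX ε X k →
        (∀ σ ∈ X.faces, σ.card = k → f σ = 0 ∨ f σ = 1) →
        IsGlobal (faceMeasure X k) d δ (onTuples k f) →
        l2norm (faceMeasure X k) (lowDegree (faceMeasure X k) d (onTuples k f)) ^ 2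
          ≤ ζ * l2norm (faceMeasure X k) (onTuples k f) ^ 2)) := by
  -- Each of the two terms gets `ζ / 2`. The coefficient of `√δ` does not involve `k`, which is why
  -- `δ₀` can be chosen before `k`.
  have small : ∀ (k : ℕ) (ζ ε δ : ℝ) (d : ℕ), 0 < ζ → ε ≤ (ζ / (2 * levelConst k)) ^ 2 →
      δ ≤ (ζ / (2 * ((200 * (d : ℝ)) ^ d + 1))) ^ 2 →
      levelConst k * √ε + (200 * (d : ℝ)) ^ d * √δ ≤ ζ := by
    intro k ζ ε δ d hζ hε hδ
    have hC := levelConst_pos k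
    have hD : 0 ≤ (200 * (d : ℝ)) ^ d := by positivity
    have h1 : √ε ≤ ζ / (2 * levelConst k) := Real.sqrt_le_iff.2 ⟨by positivity, hε⟩
    have h2 : √δ ≤ ζ / (2 * ((200 * (d : ℝ)) ^ d + 1)) :=
      Real.sqrt_le_iff.2 ⟨by positivity, hδ⟩
    rw [le_div_iff₀ (by positivity)] at h1 h2
    have h3 := Real.sqrt_nonneg δ
    linarith
  have product : ∀ (k : ℕ) (V : Fin k → Type u) [∀ i, Fintype (V i)] (μ : (∀ i, V i) → ℝ)
      (ε δ : ℝ) (d : ℕ) (f : (∀ i, V i) → ℝ),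
      μ ∈ stdSimplex ℝ (∀ i, V i) → 0 ≤ ε → IsEpsProduct ε μ →
      (∀ x, 0 < μ x → f x = 0 ∨ f x = 1) → IsGlobal μ d δ f →
      l2norm μ (lowDegree μ d f) ^ 2
        ≤ (levelConst k * √ε + (200 * (d : ℝ)) ^ d * √δ) * l2norm μ f ^ 2 :=
    fun k V _ μ ε δ d f hμ hε hp hf hg => hp.level_inequality hμ hε
      (fun x hx => hf x (lt_of_le_of_ne (hμ.1 x) hx.symm)) hg
  have complexes : ∀ (k : ℕ) (V : Type v) [Fintype V] [DecidableEq V]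
      (X : PreAbstractSimplicialComplex V) (ε δ : ℝ) (d : ℕ) (f : Finset V → ℝ),
      0 ≤ ε → IsHDX ε X k → (∀ σ ∈ X.faces, σ.card = k → f σ = 0 ∨ f σ = 1) →
      IsGlobal (faceMeasure X k) d δ (onTuples k f) →
      l2norm (faceMeasure X k) (lowDegree (faceMeasure X k) d (onTuples k f)) ^ 2
        ≤ (levelConst k * √ε + (200 * (d : ℝ)) ^ d * √δ)
          * l2norm (faceMeasure X k) (onTuples k f) ^ 2 := by
    intro k V _ _ X ε δ d f hε hX hf hg
    refine (hX.isEpsProduct hε).level_inequality hX.1.faceMeasure_mem_stdSimplex hε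
      (fun x hx => ?_) hg
    obtain ⟨hinj, hface⟩ := mem_orderedFaces.1 (mem_orderedFaces_of_faceMeasure_ne_zero hx)
    refine hf _ hface ?_
    rw [Finset.card_image_of_injective _ hinj, Finset.card_univ, Fintype.card_fin]
  refine ⟨fun k => ⟨levelConst k, levelConst_pos k, product k, complexes k⟩,
    fun ζ d hζ => ⟨(ζ / (2 * ((200 * (d : ℝ)) ^ d + 1))) ^ 2, by positivity, fun k =>
      ⟨(ζ / (2 * levelConst k)) ^ 2, ?_, ?_, ?_⟩⟩⟩
  · have := levelConst_pos k
    positivity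
  · intro V _ μ ε δ f hμ hε hε₀ hδ hp hf hg
    exact (product k V μ ε δ d f hμ hε hp hf hg).trans
      (mul_le_mul_of_nonneg_right (small k ζ ε δ d hζ hε₀ hδ) (sq_nonneg _))
  · intro V _ _ X ε δ f hε hε₀ hδ hX hf hg
    exact (complexes k V X ε δ d f hε hX hf hg).trans
      (mul_le_mul_of_nonneg_right (small k ζ ε δ d hζ hε₀ hδ) (sq_nonneg _))
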